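/- Let $G=\mathrm{Spin}^+_{1,3}$ be the connected spin group of Minkowski space, i.e. the Lie group of all elements $x$ of the real Clifford algebra of $\mathbb R^{1,3}$ that are products of an even number of invertible vectors and satisfy $x\,x^{*}=1$, where $*$ is the anti-automorphism with $v^{*}=-v$ on vectors. Let $M$ be a (finite-dimensional, second countable, Hausdorff) smooth manifold with a smooth action of $G$. Each orbit of $G$ is regarded as an immersed submanifold of $M$, with the topology of the quotient of $G$ by the stabilizer. Denote by $A$ the ideal of the differential forms on $M$ whose restriction (pullback) to each orbit of $G$ vanishes. Let $E\in\Omega^6(M)$ and $P\in\Omega^5(M)$ be smooth differential forms such that - $E$ is $G$-invariant, i.e. $g^*E=E$ for all $g\in G$; - the restriction of $P$ to each orbit of $G$ has compact support in this orbit; - $E\equiv dP \pmod A$. Then $E\equiv dP\equiv 0 \pmod A$, i.e. the restrictions of $E$ and of $dP$ to each orbit of $G$ vanish. -/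

import Mathlib

open scoped Manifold ContDiff

noncomputable section

/-! ### The group `Spin⁺(1,3)`

The group is Mathlib's `spinGroup` of the real Clifford algebra of Minkowski space. It carries the
subspace topology of this finite-dimensional algebra, and the smooth structure for which the
half-spin representation is a diffeomorphism onto `SL(2, ℂ)`. The lemmas below prove what is
needed for this, and that it is a Lie group. -/

/-- Minkowski space is `ℝ⁴` with the scalar product `⟨v, w⟩` of signature `(+---)`. This is
the quadratic form `v ↦ -⟨v, v⟩`, so that `u v + v u = -2 ⟨u, v⟩` in its Clifford algebra. -/
def cliffordForm : QuadraticForm ℝ (Fin 4 → ℝ) :=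
  QuadraticMap.weightedSumSquares ℝ ![(-1 : ℝ), 1, 1, 1]

/-- The real Clifford algebra of Minkowski space. -/
abbrev Cl13 : Type := CliffordAlgebra cliffordForm

/-- The group `Spin⁺(1,3)`: the products `x` of an even number of invertible vectors such that
`x * star x = 1`, where `star` is the anti-automorphism with `star v = -v` on vectors. The norm is
required to be `1` (not `±1`), so this is the connected double cover of the proper
orthochronous Lorentz group; see `SpinPlus13.equivSL` for the isomorphism with `SL(2, ℂ)`. -/
abbrev SpinPlus13 : Type := spinGroup cliffordForm

namespace SpinPlus13

open CliffordAlgebra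

theorem cliffordForm_apply (v : Fin 4 → ℝ) :
    cliffordForm v = - v 0 * v 0 + v 1 * v 1 + v 2 * v 2 + v 3 * v 3 := by
  simp [cliffordForm, QuadraticMap.weightedSumSquares_apply, Fin.sum_univ_four]

/-- The Hermitian matrix `v⁰ + vⁱσᵢ`, for the Pauli matrices `σᵢ`. -/
def slash : (Fin 4 → ℝ) →ₗ[ℝ] Matrix (Fin 2) (Fin 2) ℂ where
  toFun v := !![(v 0 + v 3 : ℂ), v 1 - v 2 * Complex.I; v 1 + v 2 * Complex.I, v 0 - v 3]
  map_add' v w := by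
    ext i j; fin_cases i <;> fin_cases j <;> simp <;> ring
  map_smul' r v := by
    ext i j; fin_cases i <;> fin_cases j <;> simp <;> ring

/-- The Hermitian matrix `v⁰ - vⁱσᵢ`, for the Pauli matrices `σᵢ`. -/
def slashBar : (Fin 4 → ℝ) →ₗ[ℝ] Matrix (Fin 2) (Fin 2) ℂ where
  toFun v := !![(v 0 - v 3 : ℂ), - v 1 + v 2 * Complex.I; - v 1 - v 2 * Complex.I, v 0 + v 3]
  map_add' v w := by
    ext i j; fin_cases i <;> fin_cases j <;> simp <;> ring
  map_smul' r v := by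
    ext i j; fin_cases i <;> fin_cases j <;> simp <;> ring

theorem slash_mul_slashBar (v : Fin 4 → ℝ) :
    slash v * slashBar v = algebraMap ℝ _ (- cliffordForm v) := by
  rw [cliffordForm_apply]
  ext i j; fin_cases i <;> fin_cases j <;>
    simp [slash, slashBar, Matrix.mul_apply, Fin.sum_univ_two, Matrix.algebraMap_matrix_apply] <;>
    ring_nf <;> simp <;> ring

theorem slashBar_mul_slash (v : Fin 4 → ℝ) :
    slashBar v * slash v = algebraMap ℝ _ (- cliffordForm v) := by
  rw [cliffordForm_apply]
  ext i j; fin_cases i <;> fin_cases j <;>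
    simp [slash, slashBar, Matrix.mul_apply, Fin.sum_univ_two, Matrix.algebraMap_matrix_apply] <;>
    ring_nf <;> simp <;> ring

/-- The half-spin representation of the even Clifford algebra: `v w ↦ - (v⁰ + vⁱσᵢ)(w⁰ - wⁱσᵢ)`. -/
def weylHom : EvenHom cliffordForm (Matrix (Fin 2) (Fin 2) ℂ) where
  bilin := -(LinearMap.mul ℝ (Matrix (Fin 2) (Fin 2) ℂ)).compl₁₂ slash slashBar
  contract v := by
    simp [slash_mul_slashBar]
  contract_mid u v w := by
    have h := slashBar_mul_slash v
    have : slash u * slashBar v * (slash v * slashBar w)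
        = slash u * (slashBar v * slash v) * slashBar w := by noncomm_ring
    simp [this, h, Algebra.algebraMap_eq_smul_one]

def weyl : even cliffordForm →ₐ[ℝ] Matrix (Fin 2) (Fin 2) ℂ := even.lift _ weylHom

/-- The product `v w` of two vectors, as an element of the even Clifford algebra. -/
def gen (v w : Fin 4 → ℝ) : even cliffordForm :=
  ⟨ι cliffordForm v * ι cliffordForm w, ι_mul_ι_mem_evenOdd_zero _ v w⟩

theorem weyl_gen (v w : Fin 4 → ℝ) : weyl (gen v w) = -(slash v * slashBar w) :=
  even.lift_ι _ weylHom v w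

theorem even_ind {p : even cliffordForm → Prop} (h1 : ∀ r : ℝ, p (algebraMap ℝ _ r))
    (h2 : ∀ x y, p x → p y → p (x + y)) (h3 : ∀ v w x, p x → p (gen v w * x))
    (x : even cliffordForm) : p x :=
  even_induction cliffordForm (motive := fun x hx => p ⟨x, hx⟩) h1
    (fun _ _ _ _ => h2 _ _) (fun v w _ _ => h3 v w _) x.1 x.2

/-- The canonical anti-involution, on the even Clifford algebra. -/
def starEven (x : even cliffordForm) : even cliffordForm :=
  ⟨star (x : Cl13), by
    rw [star_def]
    exact (reverse_mem_evenOdd_iff _).2 ((involute_mem_evenOdd_iff _).2 x.2)⟩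

/-- The product `e₀ eᵢ` in the Clifford algebra. -/
def boost (i : Fin 4) : Cl13 :=
  ι cliffordForm (Pi.single 0 1) * ι cliffordForm (Pi.single i 1)

theorem ι_single_mul_self (i : Fin 4) : ι cliffordForm (Pi.single i 1) * ι cliffordForm (Pi.single i 1)
    = if i = 0 then -1 else 1 := by
  rw [ι_sq_scalar, cliffordForm_apply]
  fin_cases i <;> simp

theorem ι_single_mul (i j : Fin 4) (h : i ≠ j) :
    ι cliffordForm (Pi.single i 1) * ι cliffordForm (Pi.single j 1)
    = - (ι cliffordForm (Pi.single j 1) * ι cliffordForm (Pi.single i 1)) := by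
  rw [← add_eq_zero_iff_eq_neg, ι_mul_ι_add_swap, QuadraticMap.polar]
  simp only [cliffordForm_apply]
  revert h
  fin_cases i <;> fin_cases j <;> simp

theorem boost_mul_self (i : Fin 4) (h : i ≠ 0) : boost i * boost i = 1 := by
  unfold boost
  have h1 := ι_single_mul_self 0
  have h2 := ι_single_mul_self i
  have h3 := ι_single_mul i 0 h
  simp only [h, if_true, if_false] at h1 h2
  rw [mul_assoc, ← mul_assoc (ι cliffordForm (Pi.single i 1)), h3, neg_mul, mul_assoc _ _ (ι cliffordForm (Pi.single i 1)), h2]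
  simp [h1]

theorem boost_mul_comm (i j : Fin 4) (hi : i ≠ 0) (hj : j ≠ 0) (h : i ≠ j) :
    boost i * boost j = - (boost j * boost i) := by
  unfold boost
  have h1 := ι_single_mul_self 0
  have h3 := ι_single_mul i 0 hi
  have h4 := ι_single_mul j 0 hj
  have h5 := ι_single_mul i j h
  simp only [if_true] at h1
  set a := ι cliffordForm (Pi.single 0 1)
  set b := ι cliffordForm (Pi.single i 1)
  set c := ι cliffordForm (Pi.single j 1)
  have e1 : a * b * (a * c) = b * c := by
    rw [mul_assoc, ← mul_assoc b, h3, neg_mul, mul_neg, mul_assoc a b c, ← mul_assoc a a, h1]; simp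
  have e2 : a * c * (a * b) = c * b := by
    rw [mul_assoc, ← mul_assoc c, h4, neg_mul, mul_neg, mul_assoc a c b, ← mul_assoc a a, h1]; simp
  rw [e1, e2, h5]

/-- The inverse of `weyl`. -/
def weylInv : Matrix (Fin 2) (Fin 2) ℂ →ₗ[ℝ] Cl13 where
  toFun B :=
    (((B 0 0).re + (B 1 1).re) / 2) • 1
    + (((B 0 0).im + (B 1 1).im) / 2) • (boost 1 * (boost 2 * boost 3))
    + (((B 0 1).re + (B 1 0).re) / 2) • boost 1
    + (((B 0 1).im + (B 1 0).im) / 2) • (boost 2 * boost 3)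
    + (((B 1 0).im - (B 0 1).im) / 2) • boost 2
    - (((B 0 1).re - (B 1 0).re) / 2) • (boost 1 * boost 3)
    + (((B 0 0).re - (B 1 1).re) / 2) • boost 3
    + (((B 0 0).im - (B 1 1).im) / 2) • (boost 1 * boost 2)
  map_add' A B := by simp; module
  map_smul' r B := by simp; module

theorem boost_relations :
    (boost 1 * boost 1 = 1 ∧ boost 2 * boost 2 = 1 ∧ boost 3 * boost 3 = 1) ∧
    (boost 2 * boost 1 = -(boost 1 * boost 2) ∧ boost 3 * boost 1 = -(boost 1 * boost 3) ∧
      boost 3 * boost 2 = -(boost 2 * boost 3)) := by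
  refine ⟨⟨?_, ?_, ?_⟩, ?_, ?_, ?_⟩ <;>
    first
    | exact boost_mul_self _ (by decide)
    | exact boost_mul_comm _ _ (by decide) (by decide) (by decide)

theorem boost_mul_weylInv (i : Fin 4) (hi : i ≠ 0) (B : Matrix (Fin 2) (Fin 2) ℂ) :
    boost i * weylInv B = weylInv (slash (Pi.single i 1) * B) := by
  obtain ⟨⟨h11, h22, h33⟩, h21, h31, h32⟩ := boost_relations
  have h11' (x : Cl13) : boost 1 * (boost 1 * x) = x := by rw [← mul_assoc, h11, one_mul]
  have h22' (x : Cl13) : boost 2 * (boost 2 * x) = x := by rw [← mul_assoc, h22, one_mul]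
  have h21' (x : Cl13) : boost 2 * (boost 1 * x) = -(boost 1 * (boost 2 * x)) := by
    rw [← mul_assoc, h21, neg_mul, mul_assoc]
  have h31' (x : Cl13) : boost 3 * (boost 1 * x) = -(boost 1 * (boost 3 * x)) := by
    rw [← mul_assoc, h31, neg_mul, mul_assoc]
  have h32' (x : Cl13) : boost 3 * (boost 2 * x) = -(boost 2 * (boost 3 * x)) := by
    rw [← mul_assoc, h32, neg_mul, mul_assoc]
  fin_cases i
  · exact absurd rfl hi
  all_goals
    simp [weylInv, slash, Matrix.vecMul, dotProduct, Fin.sum_univ_two, mul_add, mul_sub,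
      h11, h22, h33, h21, h31, h32, h11', h22', h21', h31', h32']
    module

theorem vec_eq (v : Fin 4 → ℝ) : v = v 0 • Pi.single 0 1 + v 1 • Pi.single 1 1
    + v 2 • Pi.single 2 1 + v 3 • Pi.single 3 1 := by
  ext i; fin_cases i <;> simp

theorem ι_single_zero_mul_ι_mul_weylInv (u : Fin 4 → ℝ) (B : Matrix (Fin 2) (Fin 2) ℂ) :
    ι cliffordForm (Pi.single 0 1) * (ι cliffordForm u * weylInv B)
      = weylInv (-(slashBar u * B)) := by
  have h0 := ι_single_mul_self 0
  simp only [if_true] at h0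
  have : ι cliffordForm (Pi.single 0 1) * (ι cliffordForm u * weylInv B)
      = - (u 0 • weylInv B) + u 1 • (boost 1 * weylInv B) + u 2 • (boost 2 * weylInv B)
        + u 3 • (boost 3 * weylInv B) := by
    conv_lhs => rw [vec_eq u]
    simp only [map_add, map_smul, add_mul, mul_add, smul_mul_assoc, mul_smul_comm, boost,
      mul_assoc]
    rw [← mul_assoc (ι cliffordForm (Pi.single 0 1)) (ι cliffordForm (Pi.single 0 1)), h0]
    simp
  rw [this, boost_mul_weylInv _ (by decide), boost_mul_weylInv _ (by decide),
    boost_mul_weylInv _ (by decide)]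
  simp only [← map_smul, ← map_neg, ← map_add]
  congr 1
  ext i j
  fin_cases i <;> fin_cases j <;>
    simp [slash, slashBar, Matrix.vecMul, dotProduct, Fin.sum_univ_two] <;> ring

theorem ι_mul_ι_single_zero_mul_weylInv (u : Fin 4 → ℝ) (B : Matrix (Fin 2) (Fin 2) ℂ) :
    ι cliffordForm u * (ι cliffordForm (Pi.single 0 1) * weylInv B)
      = weylInv (-(slash u * B)) := by
  have h : ι cliffordForm u * ι cliffordForm (Pi.single 0 1)
      = -(ι cliffordForm (Pi.single 0 1) * ι cliffordForm u) + (-(2 * u 0)) • 1 := by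
    have := ι_mul_ι_add_swap (Q := cliffordForm) u (Pi.single 0 1)
    rw [eq_sub_of_add_eq this, Algebra.algebraMap_eq_smul_one, QuadraticMap.polar]
    simp only [cliffordForm_apply]
    rw [sub_eq_neg_add]
    congr 2
    simp
    ring
  rw [← mul_assoc, h, add_mul, neg_mul, mul_assoc, ι_single_zero_mul_ι_mul_weylInv, smul_mul_assoc,
    one_mul]
  simp only [← map_smul, ← map_neg, ← map_add]
  congr 1
  ext i j
  fin_cases i <;> fin_cases j <;>
    simp [slash, slashBar, Matrix.vecMul, dotProduct, Fin.sum_univ_two] <;> ring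

theorem ι_mul_ι_mul_weylInv (v w : Fin 4 → ℝ) (B : Matrix (Fin 2) (Fin 2) ℂ) :
    ι cliffordForm v * ι cliffordForm w * weylInv B = weylInv (-(slash v * slashBar w) * B) := by
  have h0 := ι_single_mul_self 0
  simp only [if_true] at h0
  have h : ι cliffordForm v * ι cliffordForm w * weylInv B =
      -(ι cliffordForm v * (ι cliffordForm (Pi.single 0 1) * (ι cliffordForm (Pi.single 0 1) *
        (ι cliffordForm w * weylInv B)))) := by
    rw [← mul_assoc (ι cliffordForm (Pi.single 0 1)), h0]
    simp [mul_assoc]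
  rw [h, ι_single_zero_mul_ι_mul_weylInv, ι_mul_ι_single_zero_mul_weylInv, ← map_neg]
  simp [mul_assoc]

theorem weylInv_weyl (x : even cliffordForm) : weylInv (weyl x) = x := by
  induction x using even_ind with
  | h1 r =>
    rw [AlgHom.commutes]
    simp [weylInv, Algebra.algebraMap_eq_smul_one]
  | h2 x y hx hy => rw [map_add, map_add, hx, hy]; rfl
  | h3 v w x h =>
    rw [map_mul, weyl_gen, ← ι_mul_ι_mul_weylInv, h]; rfl

theorem adjugate_slash (v : Fin 4 → ℝ) : (slash v).adjugate = slashBar v := by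
  ext i j; fin_cases i <;> fin_cases j <;> simp [slash, slashBar, Matrix.adjugate_fin_two]
  all_goals ring

theorem adjugate_slashBar (v : Fin 4 → ℝ) : (slashBar v).adjugate = slash v := by
  ext i j; fin_cases i <;> fin_cases j <;> simp [slash, slashBar, Matrix.adjugate_fin_two]
  all_goals ring

theorem weyl_star (x : even cliffordForm) : weyl (starEven x) = (weyl x).adjugate := by
  induction x using even_ind with
  | h1 r =>
    have h : starEven (algebraMap ℝ _ r) = algebraMap ℝ _ r := Subtype.ext (star_algebraMap r)
    rw [h, AlgHom.commutes]
    ext i j; fin_cases i <;> fin_cases j <;>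
      simp [Matrix.adjugate_fin_two, Matrix.algebraMap_matrix_apply]
  | h2 x y hx hy =>
    have h : starEven (x + y) = starEven x + starEven y := Subtype.ext (star_add _ _)
    rw [h, map_add, map_add, hx, hy]
    ext i j; fin_cases i <;> fin_cases j <;> simp [Matrix.adjugate_fin_two]
    all_goals ring
  | h3 v w x hx =>
    have h : starEven (gen v w * x) = starEven x * gen w v := by
      apply Subtype.ext
      change star (ι cliffordForm v * ι cliffordForm w * (x : Cl13))
        = star (x : Cl13) * (ι cliffordForm w * ι cliffordForm v)
      simp [star_mul, star_ι]
    have hn (A : Matrix (Fin 2) (Fin 2) ℂ) : (-A).adjugate = -A.adjugate := by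
      ext i j; fin_cases i <;> fin_cases j <;> simp [Matrix.adjugate_fin_two]
    rw [h, map_mul, map_mul, weyl_gen, weyl_gen, hx, Matrix.adjugate_mul_distrib, hn,
      Matrix.adjugate_mul_distrib, adjugate_slashBar, adjugate_slash]

/-- An element of the spin group, seen in the even Clifford algebra. -/
def toEven (x : SpinPlus13) : even cliffordForm := ⟨x, spinGroup.mem_even x.2⟩

/-- The group homomorphism to `SL(2, ℂ)` given by the half-spin representation. -/
def toSL : SpinPlus13 →* Matrix.SpecialLinearGroup (Fin 2) ℂ where
  toFun x := ⟨weyl (toEven x), by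
    have e : toEven x * starEven (toEven x) = 1 :=
      Subtype.ext (spinGroup.mul_star_self_of_mem x.2)
    have e2 := congrArg weyl e
    rw [map_mul, weyl_star, Matrix.mul_adjugate, map_one] at e2
    simpa using congrFun (congrFun e2 0) 0⟩
  map_one' := Subtype.ext (map_one weyl)
  map_mul' x y := Subtype.ext (map_mul weyl (toEven x) (toEven y))

theorem toSL_val (x : SpinPlus13) :
    (toSL x : Matrix (Fin 2) (Fin 2) ℂ) = weyl (toEven x) := rfl

theorem weylInv_toSL (x : SpinPlus13) : weylInv (toSL x : Matrix (Fin 2) (Fin 2) ℂ) = x := by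
  rw [toSL_val, weylInv_weyl]; rfl

theorem toSL_injective : Function.Injective toSL := fun x y h => by
  apply Subtype.ext
  rw [← weylInv_toSL x, h, weylInv_toSL]

theorem ι_mul_ι_mem_spinGroup (v w : Fin 4 → ℝ) (h : cliffordForm v * cliffordForm w = 1) :
    ι cliffordForm v * ι cliffordForm w ∈ spinGroup cliffordForm := by
  have hv : cliffordForm v ≠ 0 := left_ne_zero_of_mul_eq_one h
  have hw : cliffordForm w ≠ 0 := right_ne_zero_of_mul_eq_one h
  have hs : star (ι cliffordForm v * ι cliffordForm w) = ι cliffordForm w * ι cliffordForm v := by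
    simp [star_mul, star_ι]
  have key (a b : Fin 4 → ℝ) (h : cliffordForm a * cliffordForm b = 1) :
      ι cliffordForm a * ι cliffordForm b * (ι cliffordForm b * ι cliffordForm a) = 1 := by
    rw [mul_assoc, ← mul_assoc (ι cliffordForm b), ι_sq_scalar, Algebra.commutes, ← mul_assoc,
      ι_sq_scalar, ← map_mul, h, map_one]
  have unit (a : Fin 4 → ℝ) (ha : cliffordForm a ≠ 0) :
      ∃ u : (CliffordAlgebra cliffordForm)ˣ, (u : CliffordAlgebra cliffordForm) = ι cliffordForm a ∧
        u ∈ lipschitzGroup cliffordForm := by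
    have hu : IsUnit (ι cliffordForm a) := isUnit_ι_of_isUnit _ (IsUnit.mk0 _ ha)
    obtain ⟨u, hu⟩ := hu
    exact ⟨u, hu, Subgroup.subset_closure ⟨a, hu.symm⟩⟩
  obtain ⟨a, ha, ha'⟩ := unit v hv
  obtain ⟨b, hb, hb'⟩ := unit w hw
  refine ⟨⟨⟨a * b, mul_mem ha' hb', by simp [ha, hb]⟩, ?_, ?_⟩, ι_mul_ι_mem_evenOdd_zero _ v w⟩
  · rw [hs]; exact key w v (by rwa [mul_comm])
  · rw [hs]; exact key v w h

theorem mul_mem_range_toSL (v w : Fin 4 → ℝ) (h : cliffordForm v * cliffordForm w = 1)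
    (A : Matrix.SpecialLinearGroup (Fin 2) ℂ)
    (hA : (A : Matrix (Fin 2) (Fin 2) ℂ) = -(slash v * slashBar w)) : A ∈ toSL.range :=
  ⟨⟨_, ι_mul_ι_mem_spinGroup v w h⟩, Subtype.ext (by rw [hA]; exact weyl_gen v w)⟩

/-- Upper triangular transvection. -/
def upper (z : ℂ) : Matrix.SpecialLinearGroup (Fin 2) ℂ := ⟨!![1, z; 0, 1], by simp⟩

/-- Lower triangular transvection. -/
def lower (z : ℂ) : Matrix.SpecialLinearGroup (Fin 2) ℂ := ⟨!![1, 0; z, 1], by simp⟩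

theorem exists_polar (z : ℂ) :
    ∃ (x : ℝ) (a b : ℝ), a * a + b * b = 1 ∧ z = x * (a + b * Complex.I) := by
  by_cases h : z = 0
  · exact ⟨0, 1, 0, by simp, by simp [h]⟩
  · have h' : ‖z‖ ≠ 0 := norm_ne_zero_iff.2 h
    refine ⟨‖z‖, z.re / ‖z‖, z.im / ‖z‖, ?_, ?_⟩
    · have := Complex.sq_norm z
      rw [Complex.normSq_apply] at this
      field_simp
      linarith
    · have h2 : (‖z‖ : ℂ) ≠ 0 := by exact_mod_cast h'
      push_cast
      field_simp
      exact (Complex.re_add_im z).symm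

theorem upper_mem_range (z : ℂ) : upper z ∈ toSL.range := by
  obtain ⟨x, a, b, hab, rfl⟩ := exists_polar z
  refine mul_mem_range_toSL ![x / 2, a, -b, x / 2] ![0, a, -b, 0] ?_ _ ?_
  · rw [cliffordForm_apply, cliffordForm_apply]
    simp
    linear_combination (a * a + b * b + 1) * hab
  · have : (a : ℂ) * a + b * b = 1 := by exact_mod_cast hab
    ext i j; fin_cases i <;> fin_cases j <;> simp [slash, slashBar, upper]
    · linear_combination (-1) * this + b * b * Complex.I_mul_I
    · ring
    · linear_combination (-1) * this + b * b * Complex.I_mul_I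

theorem lower_mem_range (z : ℂ) : lower z ∈ toSL.range := by
  obtain ⟨x, a, b, hab, rfl⟩ := exists_polar z
  refine mul_mem_range_toSL ![x / 2, a, b, -x / 2] ![0, a, b, 0] ?_ _ ?_
  · rw [cliffordForm_apply, cliffordForm_apply]
    simp
    linear_combination (a * a + b * b + 1) * hab
  · have : (a : ℂ) * a + b * b = 1 := by exact_mod_cast hab
    ext i j; fin_cases i <;> fin_cases j <;> simp [slash, slashBar, lower]
    all_goals first
      | linear_combination (-1) * this + b * b * Complex.I_mul_I
      | linear_combination this - b * b * Complex.I_mul_I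
      | exact Or.inl (by ring)
      | ring

theorem toSL_surjective : Function.Surjective toSL := by
  rw [← MonoidHom.range_eq_top, eq_top_iff]
  have key (A : Matrix.SpecialLinearGroup (Fin 2) ℂ) (h : A 1 0 ≠ 0) : A ∈ toSL.range := by
    have hA : A = upper ((A 0 0 - 1) / A 1 0) * lower (A 1 0) * upper ((A 1 1 - 1) / A 1 0) := by
      have hd := A.det_coe
      rw [Matrix.det_fin_two] at hd
      apply Subtype.ext
      rw [Matrix.SpecialLinearGroup.coe_mul, Matrix.SpecialLinearGroup.coe_mul]
      ext i j
      fin_cases i <;> fin_cases j <;>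
        simp [upper, lower] <;> field_simp
      all_goals first
        | linear_combination (-1) * hd
        | linear_combination hd
        | ring
    rw [hA]
    exact mul_mem (mul_mem (upper_mem_range _) (lower_mem_range _)) (upper_mem_range _)
  intro A _
  by_cases h : A 1 0 = 0
  · have h0 : A 0 0 ≠ 0 := by
      intro h0
      have hd := A.det_coe
      rw [Matrix.det_fin_two, h, h0] at hd
      simp at hd
    have h1 : (lower 1 * A) 1 0 ≠ 0 := by
      rw [Matrix.SpecialLinearGroup.coe_mul]
      simpa [lower, Matrix.vecMul, dotProduct, Fin.sum_univ_two, h] using h0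
    exact (mul_mem_cancel_left (lower_mem_range 1)).1 (key _ h1)
  · exact key A h

/-- The exceptional isomorphism with `SL(2, ℂ)`. -/
def equivSL : SpinPlus13 ≃* Matrix.SpecialLinearGroup (Fin 2) ℂ :=
  MulEquiv.ofBijective toSL ⟨toSL_injective, toSL_surjective⟩


/-- The canonical topology of a finite-dimensional real vector space. -/
instance : TopologicalSpace Cl13 := moduleTopology ℝ Cl13

instance : IsModuleTopology ℝ Cl13 := ⟨rfl⟩

instance : ContinuousAdd Cl13 := IsModuleTopology.toContinuousAdd ℝ Cl13

instance : IsTopologicalAddGroup Cl13 := IsModuleTopology.topologicalAddGroup ℝ Cl13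

theorem equivSL_symm_val (A : Matrix.SpecialLinearGroup (Fin 2) ℂ) :
    (equivSL.symm A : Cl13) = weylInv A := by
  conv_rhs => rw [← equivSL.apply_symm_apply A]
  exact (weylInv_toSL _).symm

theorem continuous_toSL : Continuous toSL := by
  obtain ⟨f, hf⟩ := LinearMap.exists_extend (p := Subalgebra.toSubmodule (even cliffordForm))
    weyl.toLinearMap
  have hc : Continuous f := IsModuleTopology.continuous_of_linearMap f
  refine Continuous.subtype_mk ?_ _
  refine (hc.comp continuous_subtype_val).congr fun x => ?_
  exact LinearMap.congr_fun hf (toEven x)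

theorem continuous_equivSL_symm : Continuous equivSL.symm := by
  refine continuous_induced_rng.2 ?_
  have hc : Continuous weylInv := weylInv.continuous_of_finiteDimensional
  exact (hc.comp continuous_subtype_val).congr fun A => (equivSL_symm_val A).symm

/-- The entries of the matrix in `SL(2, ℂ)` of an element of the spin group. -/
def entry (i j : Fin 2) (g : SpinPlus13) : ℂ := (toSL g : Matrix (Fin 2) (Fin 2) ℂ) i j

theorem continuous_entry (i j : Fin 2) : Continuous (entry i j) :=
  (continuous_subtype_val.comp continuous_toSL).matrix_elem i j

theorem entry_det (g : SpinPlus13) :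
    entry 0 0 g * entry 1 1 g - entry 0 1 g * entry 1 0 g = 1 := by
  have := (toSL g).det_coe
  rwa [Matrix.det_fin_two] at this

/-- The element of the spin group with given matrix in `SL(2, ℂ)`. -/
def ofEntries (a b c d : ℂ) (h : a * d - b * c = 1) : SpinPlus13 :=
  equivSL.symm ⟨!![a, b; c, d], by rw [Matrix.det_fin_two_of]; exact h⟩

theorem toSL_ofEntries (a b c d : ℂ) (h : a * d - b * c = 1) :
    (toSL (ofEntries a b c d h) : Matrix (Fin 2) (Fin 2) ℂ) = !![a, b; c, d] :=
  congrArg Subtype.val (equivSL.apply_symm_apply ⟨!![a, b; c, d], _⟩)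

theorem ext_entry {g h : SpinPlus13} (H : ∀ i j, entry i j g = entry i j h) : g = h :=
  toSL_injective (Subtype.ext (Matrix.ext H))

theorem isInducing_toSL :
    Topology.IsInducing fun g => (toSL g : Matrix (Fin 2) (Fin 2) ℂ) := by
  let e : SpinPlus13 ≃ₜ Matrix.SpecialLinearGroup (Fin 2) ℂ :=
    { equivSL.toEquiv with
      continuous_toFun := continuous_toSL
      continuous_invFun := continuous_equivSL_symm }
  exact Topology.IsInducing.subtypeVal.comp e.isInducing

theorem continuousOn_of_entry {X : Type*} [TopologicalSpace X] {s : Set X} {f : X → SpinPlus13}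
    (h : ∀ i j, ContinuousOn (fun x => entry i j (f x)) s) : ContinuousOn f s := by
  rw [isInducing_toSL.continuousOn_iff]
  exact continuousOn_pi.2 fun i => continuousOn_pi.2 fun j => h i j

open Classical in
/-- The chart `(a, b, c)` on the open set `a ≠ 0`, for the matrix entries `a, b; c, d`. -/
def chartA : OpenPartialHomeomorph SpinPlus13 (ℂ × ℂ × ℂ) where
  toFun g := (entry 0 0 g, entry 0 1 g, entry 1 0 g)
  invFun p := if h : p.1 ≠ 0 then ofEntries p.1 p.2.1 p.2.2 ((1 + p.2.1 * p.2.2) / p.1)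
    (by field_simp; ring) else 1
  source := {g | entry 0 0 g ≠ 0}
  target := {p | p.1 ≠ 0}
  map_source' g hg := hg
  map_target' p hp := by
    have hp' : p.1 ≠ 0 := hp
    simp [hp', entry, toSL_ofEntries]
  left_inv' g hg := by
    have hg' : entry 0 0 g ≠ 0 := hg
    have := entry_det g
    apply ext_entry
    intro i j
    simp only [ne_eq, hg', not_false_eq_true, dite_true]
    unfold entry
    rw [toSL_ofEntries]
    fin_cases i <;> fin_cases j <;> simp
    unfold entry at *
    field_simp
    linear_combination (-1) * this
  right_inv' p hp := by
    have hp' : p.1 ≠ 0 := hp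
    simp [hp', entry, toSL_ofEntries]
  open_source := isOpen_ne.preimage (continuous_entry 0 0)
  open_target := isOpen_ne.preimage continuous_fst
  continuousOn_toFun := (((continuous_entry 0 0).prodMk
    ((continuous_entry 0 1).prodMk (continuous_entry 1 0)))).continuousOn
  continuousOn_invFun := by
    refine continuousOn_of_entry fun i j => ?_
    have h : ContinuousOn (fun p : ℂ × ℂ × ℂ =>
        !![p.1, p.2.1; p.2.2, (1 + p.2.1 * p.2.2) / p.1] i j) {p | p.1 ≠ 0} := by
      fin_cases i <;> fin_cases j <;> simp <;> fun_prop (disch := simp)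
    refine h.congr fun p hp => ?_
    have hp' : p.1 ≠ 0 := hp
    simp [hp', entry, toSL_ofEntries]

open Classical in
/-- The chart `(a, b, d)` on the open set `b ≠ 0`, for the matrix entries `a, b; c, d`. -/
def chartB : OpenPartialHomeomorph SpinPlus13 (ℂ × ℂ × ℂ) where
  toFun g := (entry 0 0 g, entry 0 1 g, entry 1 1 g)
  invFun p := if h : p.2.1 ≠ 0 then ofEntries p.1 p.2.1 ((p.1 * p.2.2 - 1) / p.2.1) p.2.2
    (by field_simp; ring) else 1
  source := {g | entry 0 1 g ≠ 0}
  target := {p | p.2.1 ≠ 0}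
  map_source' g hg := hg
  map_target' p hp := by
    have hp' : p.2.1 ≠ 0 := hp
    simp [hp', entry, toSL_ofEntries]
  left_inv' g hg := by
    have hg' : entry 0 1 g ≠ 0 := hg
    have := entry_det g
    apply ext_entry
    intro i j
    simp only [ne_eq, hg', not_false_eq_true, dite_true]
    unfold entry
    rw [toSL_ofEntries]
    fin_cases i <;> fin_cases j <;> simp
    unfold entry at *
    field_simp
    linear_combination this
  right_inv' p hp := by
    have hp' : p.2.1 ≠ 0 := hp
    simp [hp', entry, toSL_ofEntries]
  open_source := isOpen_ne.preimage (continuous_entry 0 1)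
  open_target := isOpen_ne.preimage (continuous_fst.comp continuous_snd)
  continuousOn_toFun := (((continuous_entry 0 0).prodMk
    ((continuous_entry 0 1).prodMk (continuous_entry 1 1)))).continuousOn
  continuousOn_invFun := by
    refine continuousOn_of_entry fun i j => ?_
    have h : ContinuousOn (fun p : ℂ × ℂ × ℂ =>
        !![p.1, p.2.1; (p.1 * p.2.2 - 1) / p.2.1, p.2.2] i j) {p | p.2.1 ≠ 0} := by
      fin_cases i <;> fin_cases j <;> simp <;> fun_prop (disch := simp)
    refine h.congr fun p hp => ?_
    have hp' : p.2.1 ≠ 0 := hp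
    simp [hp', entry, toSL_ofEntries]

theorem entry_chartA_symm (i j : Fin 2) (p : ℂ × ℂ × ℂ) (hp : p.1 ≠ 0) :
    entry i j (chartA.symm p) = !![p.1, p.2.1; p.2.2, (1 + p.2.1 * p.2.2) / p.1] i j := by
  simp [chartA, hp, entry, toSL_ofEntries]

theorem entry_chartB_symm (i j : Fin 2) (p : ℂ × ℂ × ℂ) (hp : p.2.1 ≠ 0) :
    entry i j (chartB.symm p) = !![p.1, p.2.1; (p.1 * p.2.2 - 1) / p.2.1, p.2.2] i j := by
  simp [chartB, hp, entry, toSL_ofEntries]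

open Classical in
/-- The smooth structure of the `6`-dimensional Lie group `Spin⁺(1,3)`, by two charts. -/
instance : ChartedSpace (ℂ × ℂ × ℂ) SpinPlus13 where
  atlas := {chartA, chartB}
  chartAt g := if entry 0 0 g ≠ 0 then chartA else chartB
  mem_chart_source g := by
    by_cases h : entry 0 0 g ≠ 0
    · rw [if_pos h]; exact h
    · rw [if_neg h]
      intro h'
      have := entry_det g
      rw [not_not] at h
      simp [h, h'] at this
  chart_mem_atlas g := by
    by_cases h : entry 0 0 g ≠ 0
    · rw [if_pos h]; exact Or.inl rfl
    · rw [if_neg h]; exact Or.inr rfl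

/-- Matrix entries are smooth in the inverse charts. -/
theorem contDiffOn_entry_symm (e : OpenPartialHomeomorph SpinPlus13 (ℂ × ℂ × ℂ))
    (he : e ∈ atlas (ℂ × ℂ × ℂ) SpinPlus13) (i j : Fin 2) :
    ContDiffOn ℝ ∞ (fun p => entry i j (e.symm p)) e.target := by
  rcases he with rfl | rfl
  · have h : ContDiffOn ℝ ∞ (fun p : ℂ × ℂ × ℂ =>
        !![p.1, p.2.1; p.2.2, (1 + p.2.1 * p.2.2) / p.1] i j) {p | p.1 ≠ 0} := by
      fin_cases i <;> fin_cases j <;> simp [div_eq_mul_inv] <;> try fun_prop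
      exact ContDiffOn.mul (by fun_prop) (ContDiffOn.inv (by fun_prop) fun p hp => hp)
    exact h.congr fun p hp => entry_chartA_symm i j p hp
  · have h : ContDiffOn ℝ ∞ (fun p : ℂ × ℂ × ℂ =>
        !![p.1, p.2.1; (p.1 * p.2.2 - 1) / p.2.1, p.2.2] i j) {p | p.2.1 ≠ 0} := by
      fin_cases i <;> fin_cases j <;> simp [div_eq_mul_inv] <;> try fun_prop
      exact ContDiffOn.mul (by fun_prop) (ContDiffOn.inv (by fun_prop) fun p hp => hp)
    exact h.congr fun p hp => entry_chartB_symm i j p hp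

theorem exists_entries_of_mem_atlas (e : OpenPartialHomeomorph SpinPlus13 (ℂ × ℂ × ℂ))
    (he : e ∈ atlas (ℂ × ℂ × ℂ) SpinPlus13) :
    ∃ i j : Fin 2, ∀ g, e g = (entry 0 0 g, entry 0 1 g, entry i j g) := by
  rcases he with rfl | rfl
  · exact ⟨1, 0, fun g => rfl⟩
  · exact ⟨1, 1, fun g => rfl⟩

instance : IsManifold 𝓘(ℝ, ℂ × ℂ × ℂ) ∞ SpinPlus13 := by
  refine isManifold_of_contDiffOn _ _ _ fun e e' he he' => ?_
  obtain ⟨i, j, hij⟩ := exists_entries_of_mem_atlas e' he'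
  have h : ContDiffOn ℝ ∞ (fun p => (entry 0 0 (e.symm p), entry 0 1 (e.symm p),
      entry i j (e.symm p))) e.target :=
    (contDiffOn_entry_symm e he 0 0).prodMk
      ((contDiffOn_entry_symm e he 0 1).prodMk (contDiffOn_entry_symm e he i j))
  refine (h.mono ?_).congr ?_
  · intro p hp
    simp at hp
    exact hp.1
  · intro p _
    simp [hij]

theorem contMDiff_entry (i j : Fin 2) : ContMDiff 𝓘(ℝ, ℂ × ℂ × ℂ) 𝓘(ℝ, ℂ) ∞ (entry i j) := by
  intro g
  rw [contMDiffAt_iff_source, contMDiffWithinAt_iff_contDiffWithinAt]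
  simp only [mfld_simps]
  refine ((contDiffOn_entry_symm _ (chart_mem_atlas (ℂ × ℂ × ℂ) g) i j).contDiffAt ?_).contDiffWithinAt
  exact (chartAt (ℂ × ℂ × ℂ) g).open_target.mem_nhds (mem_chart_target _ g)

theorem contMDiff_of_entry {E H N : Type*} [NormedAddCommGroup E] [NormedSpace ℝ E]
    [TopologicalSpace H] {I : ModelWithCorners ℝ E H} [TopologicalSpace N] [ChartedSpace H N]
    {f : N → SpinPlus13} (h : ∀ i j, ContMDiff I 𝓘(ℝ, ℂ) ∞ fun x => entry i j (f x)) :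
    ContMDiff I 𝓘(ℝ, ℂ × ℂ × ℂ) ∞ f := by
  have hc : Continuous f := by
    rw [← continuousOn_univ]
    exact continuousOn_of_entry fun i j => (h i j).continuous.continuousOn
  intro x
  rw [contMDiffAt_iff_target]
  refine ⟨hc.continuousAt, ?_⟩
  obtain ⟨i, j, hij⟩ := exists_entries_of_mem_atlas _ (chart_mem_atlas (ℂ × ℂ × ℂ) (f x))
  have h' : ContMDiff I 𝓘(ℝ, ℂ × ℂ × ℂ) ∞
      fun x => (entry 0 0 (f x), entry 0 1 (f x), entry i j (f x)) :=
    (h 0 0).prodMk_space ((h 0 1).prodMk_space (h i j))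
  refine (h' x).congr_of_eventuallyEq (Filter.Eventually.of_forall fun y => ?_)
  simp [hij]

theorem entry_mul (i j : Fin 2) (g h : SpinPlus13) :
    entry i j (g * h) = entry i 0 g * entry 0 j h + entry i 1 g * entry 1 j h := by
  simp [entry, Matrix.mul_apply, Fin.sum_univ_two]

theorem entry_inv (g : SpinPlus13) (i j : Fin 2) :
    entry i j g⁻¹ = !![entry 1 1 g, - entry 0 1 g; - entry 1 0 g, entry 0 0 g] i j := by
  unfold entry
  rw [map_inv, Matrix.SpecialLinearGroup.coe_inv, Matrix.adjugate_fin_two]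

instance : LieGroup 𝓘(ℝ, ℂ × ℂ × ℂ) ∞ SpinPlus13 where
  contMDiff_mul := by
    refine contMDiff_of_entry fun i j => ?_
    simp only [entry_mul]
    have h1 (i j) := (contMDiff_entry i j).comp
      (contMDiff_fst (I := 𝓘(ℝ, ℂ × ℂ × ℂ)) (J := 𝓘(ℝ, ℂ × ℂ × ℂ)) (M := SpinPlus13) (N := SpinPlus13))
    have h2 (i j) := (contMDiff_entry i j).comp
      (contMDiff_snd (I := 𝓘(ℝ, ℂ × ℂ × ℂ)) (J := 𝓘(ℝ, ℂ × ℂ × ℂ)) (M := SpinPlus13) (N := SpinPlus13))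
    have h (k : Fin 2) := (contDiff_mul (𝕜 := ℝ) (𝔸 := ℂ) (n := ∞)).contMDiff.comp
      ((h1 i k).prodMk_space (h2 k j))
    exact (h 0).add (h 1)
  contMDiff_inv := by
    refine contMDiff_of_entry fun i j => ?_
    simp only [entry_inv]
    fin_cases i <;> fin_cases j <;> simp
    · exact contMDiff_entry 1 1
    · exact (contMDiff_entry 0 1).neg
    · exact (contMDiff_entry 1 0).neg
    · exact contMDiff_entry 0 0

end SpinPlus13

/-! ### Differential forms on a manifold -/

section Forms

variable (F : Type*) [NormedAddCommGroup F] [NormedSpace ℝ F]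
  (M : Type*) [TopologicalSpace M] [ChartedSpace F M]

/-- A field of alternating `k`-linear forms on the tangent spaces of `M`; the differential
`k`-forms of `M` are those that satisfy `FormField.IsSmooth`. -/
abbrev FormField (k : ℕ) : Type _ := ∀ x : M, TangentSpace 𝓘(ℝ, F) x [⋀^Fin k]→L[ℝ] ℝ

variable {F M} {k : ℕ}

namespace FormField

/-- The expression of `θ` in the preferred chart at `x₀`: the pullback of `θ` by the inverse
of this chart. It is meaningful on the target of the chart. -/
def inChart (θ : FormField F M k) (x₀ : M) : F → F [⋀^Fin k]→L[ℝ] ℝ := fun y =>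
  (θ ((extChartAt 𝓘(ℝ, F) x₀).symm y)).compContinuousLinearMap
    (mfderiv 𝓘(ℝ, F) 𝓘(ℝ, F) (extChartAt 𝓘(ℝ, F) x₀).symm y)

/-- `θ` is a smooth differential form: its expression in every chart is `C^∞`. -/
def IsSmooth (θ : FormField F M k) : Prop :=
  ∀ x₀ : M, ContDiffOn ℝ ∞ (θ.inChart x₀) (extChartAt 𝓘(ℝ, F) x₀).target

/-- The exterior derivative `dθ`: at `x`, it is computed in the preferred chart at `x` and
pulled back to the tangent space at `x` by this chart. -/
def d (θ : FormField F M k) : FormField F M (k + 1) := fun x =>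
  (extDeriv (θ.inChart x) (extChartAt 𝓘(ℝ, F) x x)).compContinuousLinearMap
    (mfderiv 𝓘(ℝ, F) 𝓘(ℝ, F) (extChartAt 𝓘(ℝ, F) x) x)

variable [MulAction SpinPlus13 M]

/-- `θ` is invariant under the group action: `g^* θ = θ` for all `g`. -/
def IsInvariant (θ : FormField F M k) : Prop :=
  ∀ (g : SpinPlus13) (x : M),
    (θ (g • x)).compContinuousLinearMap
      (mfderiv 𝓘(ℝ, F) 𝓘(ℝ, F) (fun y : M => g • y) x) = θ x

end FormField

variable [MulAction SpinPlus13 M]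

variable (F) in
/-- The tangent space at `g • x` of the orbit of `x`, which is an immersed submanifold: it is
the image of the tangent space of the group at `g` by the differential of `h ↦ h • x`. -/
def orbitTangentSpace (x : M) (g : SpinPlus13) : Submodule ℝ (TangentSpace 𝓘(ℝ, F) (g • x)) :=
  LinearMap.range
    (mfderiv 𝓘(ℝ, ℂ × ℂ × ℂ) 𝓘(ℝ, F) (fun h : SpinPlus13 => h • x) g).toLinearMap

/-- The restriction (pullback) of `θ` to the orbit of `x` vanishes at the point `g • x`. -/
def FormField.VanishesOnOrbitAt (θ : FormField F M k) (x : M) (g : SpinPlus13) : Prop :=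
  ∀ v : Fin k → TangentSpace 𝓘(ℝ, F) (g • x), (∀ i, v i ∈ orbitTangentSpace F x g) →
    θ (g • x) v = 0

variable (F M k) in
/-- The degree `k` part of the ideal of the forms whose restriction to each orbit vanishes. -/
def orbitIdeal : Submodule ℝ (FormField F M k) where
  carrier := {θ | ∀ (x : M) (g : SpinPlus13), θ.VanishesOnOrbitAt x g}
  zero_mem' := fun _ _ _ _ => rfl
  add_mem' := fun {θ η} hθ hη x g v hv => by
    have h1 := hθ x g v hv
    have h2 := hη x g v hv
    change θ (g • x) v + η (g • x) v = 0
    rw [h1, h2, add_zero]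
  smul_mem' := fun c θ hθ x g v hv => by
    have h := hθ x g v hv
    change c • θ (g • x) v = 0
    rw [h, smul_zero]

/-- The restriction of `θ` to the orbit of `x` has compact support, the orbit being an immersed
submanifold: its topology is that of the quotient of the group by the stabilizer of `x`, in
which the class of `g` is the point `g • x`. -/
def FormField.HasCompactSupportOnOrbit (θ : FormField F M k) (x : M) : Prop :=
  IsCompact (closure ((fun g : SpinPlus13 => (g : SpinPlus13 ⧸ MulAction.stabilizer SpinPlus13 x)) ''
    {g | ¬ θ.VanishesOnOrbitAt x g}))

end Forms

end

/-!
The group is `SL(2, ℂ)`, so that orbits have dimension at most `6`, and a `6`-form restricts to zero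
on an orbit as soon as it vanishes on the generators of the action given by a basis of the Lie
algebra. The basis used is that of the Pauli matrices `σₐ` and `iσₐ`; the value of a form on
generators is `orbitCoeff`.

Suppose that `E` is not zero on the orbit of `x`. As `SL(2, ℂ)` has no non-trivial characters
(`monoidHom_eq_one`), the adjoint representation has determinant `1`, and the coefficient `e` of the
invariant form `E` is a non-zero constant on the orbit (`orbitCoeff_smul_of_isInvariant`). Hence:

* the orbit map is an immersion and the stabilizer `Γ` of `x` is discrete
  (`discreteTopology_stabilizer`);
* `dP`, which agrees with `E` on the orbit, vanishes nowhere there, so that the support of `P` is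
  the whole orbit, and `G ⧸ Γ` is compact (`compactSpace_quotient`);
* `G` is unimodular, again by lack of characters, so that `G ⧸ Γ` carries a finite non-zero invariant
  measure (`exists_smulInvariantMeasure_quotient`).

Stokes' theorem on `G ⧸ Γ` now gives a contradiction, and takes the following elementary form. The
pullback of `P` to the group by the orbit map `g ↦ g • x` is evaluated on right-invariant vector
fields. The bracket of two elements of the basis is a multiple of a third one, so that the bracket
terms in the formula for the exterior derivative all have a repeated argument: `e` is a signed sum of
derivatives of functions on `G ⧸ Γ` along right-invariant vector fields (`orbitCoeff_d`). These fields
generate the left translations, which preserve the measure, so that each derivative has integral zero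
(`exists_lift_integral_eq_zero`). Thus `e` times the total mass is zero.
-/

noncomputable section

/-! ### Invariant measures on quotients by discrete cocompact subgroups -/

open MeasureTheory Set Topology in
/-- A discrete cocompact subgroup of a locally compact group has a relatively compact Borel
fundamental domain (for its action by right translations). -/
theorem exists_fundamentalDomain_of_discrete_cocompact {G : Type*} [Group G] [TopologicalSpace G]
    [IsTopologicalGroup G] [LocallyCompactSpace G]
    [MeasurableSpace G] [BorelSpace G] (Γ : Subgroup G) [DiscreteTopology Γ]
    [CompactSpace (G ⧸ Γ)] :
    ∃ D K : Set G, MeasurableSet D ∧ IsCompact K ∧ D ⊆ K ∧ ∀ x : G, ∃! γ : Γ.op, γ • x ∈ D := by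
  -- A neighbourhood `U` of `1` whose translates `g • U` map injectively to the quotient.
  obtain ⟨V, hV, hVΓ⟩ : ∃ V ∈ 𝓝 (1 : G), ∀ γ ∈ V, γ ∈ Γ → γ = 1 := by
    have h1 : ({1} : Set Γ) ∈ 𝓝 (1 : Γ) := (isOpen_discrete _).mem_nhds rfl
    obtain ⟨V, hV, hV'⟩ := mem_nhds_subtype _ _ _ |>.1 h1
    refine ⟨V, hV, fun γ hγ hγ' => ?_⟩
    have := @hV' ⟨γ, hγ'⟩ hγ
    simpa using this
  obtain ⟨C, hC, hC1⟩ := exists_compact_mem_nhds (1 : G)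
  obtain ⟨W, hW, hWV⟩ : ∃ W ∈ 𝓝 (1 : G), ∀ u ∈ W, ∀ v ∈ W, u⁻¹ * v ∈ V := by
    have hc : Filter.Tendsto (fun p : G × G => p.1⁻¹ * p.2) (𝓝 (1 : G) ×ˢ 𝓝 (1 : G)) (𝓝 1) := by
      have : ContinuousAt (fun p : G × G => p.1⁻¹ * p.2) (1, 1) := by fun_prop
      simpa [ContinuousAt, nhds_prod_eq] using this
    obtain ⟨W, hW, h⟩ := Filter.mem_prod_same_iff.1 (hc hV)
    exact ⟨W, hW, fun u hu v hv => h (mk_mem_prod hu hv)⟩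
  obtain ⟨U, hUsub, hUo, hU1⟩ := mem_nhds_iff.1 (Filter.inter_mem hW hC1)
  have hUinj : ∀ u ∈ U, ∀ v ∈ U, u⁻¹ * v ∈ Γ → u = v := fun u hu v hv h => by
    have := hVΓ _ (hWV u (hUsub hu).1 v (hUsub hv).1) h
    exact inv_mul_eq_one.1 this
  -- Finitely many of the saturated open sets `A g = g U Γ` cover `G`, by compactness of `G ⧸ Γ`.
  let A : G → Set G := fun g => {x | ∃ γ ∈ Γ, g⁻¹ * (x * γ) ∈ U}
  have hAo : ∀ g, IsOpen (A g) := fun g => by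
    have : A g = ⋃ γ ∈ Γ, (fun x => g⁻¹ * (x * γ)) ⁻¹' U := by ext; simp [A]
    rw [this]
    exact isOpen_biUnion fun γ _ => hUo.preimage (by fun_prop)
  have hAsat : ∀ g, ∀ γ ∈ Γ, ∀ x, x * γ ∈ A g ↔ x ∈ A g := fun g γ hγ x => by
    constructor
    · rintro ⟨δ, hδ, h⟩
      exact ⟨γ * δ, mul_mem hγ hδ, by rwa [← mul_assoc x]⟩
    · rintro ⟨δ, hδ, h⟩
      exact ⟨γ⁻¹ * δ, mul_mem (inv_mem hγ) hδ, by simpa [mul_assoc] using h⟩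
  obtain ⟨t, ht⟩ : ∃ t : Finset G, ⋃ g ∈ t, A g = univ := by
    have hcov : (univ : Set (G ⧸ Γ)) ⊆ ⋃ g, QuotientGroup.mk '' A g := by
      rintro q -
      induction q using QuotientGroup.induction_on with
      | H g => exact mem_iUnion.2 ⟨g, g, ⟨1, one_mem _, by simpa using hU1⟩, rfl⟩
    obtain ⟨t, ht⟩ := isCompact_univ.elim_finite_subcover _
      (fun g => QuotientGroup.isOpenMap_coe _ (hAo g)) hcov
    refine ⟨t, eq_univ_of_forall fun x => ?_⟩
    obtain ⟨g, hg, y, hy, hyx⟩ := by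
      simpa only [mem_iUnion, exists_prop] using ht (mem_univ (x : G ⧸ Γ))
    simp only [mem_iUnion, exists_prop]
    refine ⟨g, hg, ?_⟩
    have := (hAsat g (y⁻¹ * x) (QuotientGroup.eq.1 hyx) y).2 hy
    simpa using this
  let c : Fin t.card → G := fun i => t.equivFin.symm i
  -- Made disjoint, these sets remain saturated; as `B i ⊆ c i U Γ`, the set `B i ∩ c i U`
  -- contains exactly one point of each coset of `Γ` that lies in `B i`.
  let B : Fin t.card → Set G := disjointed fun i => A (c i)
  have hBA : ∀ i, B i ⊆ A (c i) := fun i => disjointed_subset _ i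
  have hBsat : ∀ i, ∀ γ ∈ Γ, ∀ x, x * γ ∈ B i ↔ x ∈ B i := fun i γ hγ x => by
    simp only [B, disjointed_eq_inter_compl, mem_inter_iff, mem_iInter, mem_compl_iff,
      hAsat _ γ hγ x]
  have hBcov : ∀ x, ∃ i, x ∈ B i := fun x => by
    have h1 : x ∈ ⋃ i, B i := by
      simp only [B]
      rw [iUnion_disjointed]
      have h2 : x ∈ ⋃ g ∈ t, A g := ht ▸ mem_univ x
      simp only [mem_iUnion, exists_prop] at h2
      obtain ⟨g, hg, hx⟩ := h2
      exact mem_iUnion.2 ⟨t.equivFin ⟨g, hg⟩, by simpa [c] using hx⟩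
    simpa using h1
  refine ⟨⋃ i, B i ∩ (fun x => (c i)⁻¹ * x) ⁻¹' U, ⋃ i, (fun x => c i * x) '' C, ?_, ?_, ?_, ?_⟩
  · refine MeasurableSet.iUnion fun i => MeasurableSet.inter ?_ ?_
    · simp only [B, disjointed_eq_inter_compl]
      exact (hAo _).measurableSet.inter (MeasurableSet.iInter fun j => MeasurableSet.iInter
        fun _ => (hAo _).measurableSet.compl)
    · exact (hUo.preimage (by fun_prop)).measurableSet
  · exact isCompact_iUnion fun i => hC.image (by fun_prop)
  · refine iUnion_mono fun i x hx => ⟨_, (hUsub hx.2).2, by simp⟩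
  · intro x
    obtain ⟨i, hi⟩ := hBcov x
    obtain ⟨γ, hγ, hγU⟩ := hBA i hi
    refine ⟨⟨MulOpposite.op γ, hγ⟩, mem_iUnion.2 ⟨i, (hBsat i γ hγ x).2 hi, hγU⟩, ?_⟩
    rintro ⟨δ, hδ⟩ hδD
    obtain ⟨j, hj, hjU⟩ := mem_iUnion.1 hδD
    have hδ' : δ.unop ∈ Γ := hδ
    have hj' : x * δ.unop ∈ B j := hj
    have hij : i = j := by
      by_contra hne
      exact (disjoint_left.1 (disjoint_disjointed (fun i => A (c i)) hne) hi)
        ((hBsat j _ hδ' x).1 hj')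
    subst hij
    have h3 : (c i)⁻¹ * (x * δ.unop) ∈ U := hjU
    have := hUinj _ h3 _ hγU (by
      have : ((c i)⁻¹ * (x * δ.unop))⁻¹ * ((c i)⁻¹ * (x * γ)) = δ.unop⁻¹ * γ := by group
      rw [this]
      exact mul_mem (inv_mem hδ') hγ)
    apply Subtype.ext
    apply MulOpposite.unop_injective
    simpa using this

open MeasureTheory Set Topology in
/-- The quotient of a unimodular group by a discrete cocompact subgroup has a finite non-zero
invariant measure. -/
theorem exists_smulInvariantMeasure_quotient {G : Type*} [Group G] [TopologicalSpace G]
    [IsTopologicalGroup G] [LocallyCompactSpace G] [PolishSpace G]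
    [MeasurableSpace G] [BorelSpace G] (ν : Measure G) [ν.IsHaarMeasure] [ν.IsMulRightInvariant]
    (Γ : Subgroup G) [DiscreteTopology Γ] [CompactSpace (G ⧸ Γ)] :
    ∃ μ : Measure (G ⧸ Γ), IsFiniteMeasure μ ∧ SMulInvariantMeasure G (G ⧸ Γ) μ ∧ μ univ ≠ 0 := by
  obtain ⟨D, K, hD, hK, hDK, hu⟩ := exists_fundamentalDomain_of_discrete_cocompact Γ
  have : Countable Γ := TopologicalSpace.separableSpace_iff_countable.1 inferInstance
  have : T2Space (G ⧸ Γ) := inferInstance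
  have : SecondCountableTopology (G ⧸ Γ) := inferInstance
  have hΓ : IsClosed (Γ : Set G) := Subgroup.isClosed_of_discrete
  have fD : IsFundamentalDomain Γ.op D ν := IsFundamentalDomain.mk' hD.nullMeasurableSet hu
  have : Measurable (QuotientGroup.mk : G → G ⧸ Γ) := continuous_quotient_mk'.measurable
  have : HasFundamentalDomain Γ.op G ν := ⟨⟨D, fD⟩⟩
  have hq : QuotientMeasureEqMeasurePreimage ν ((ν.restrict D).map (QuotientGroup.mk : G → G ⧸ Γ)) :=
    fD.quotientMeasureEqMeasurePreimage_quotientMeasure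
  refine ⟨(ν.restrict D).map QuotientGroup.mk, ?_, ?_, ?_⟩
  · have : IsFiniteMeasure (ν.restrict D) := by
      rw [isFiniteMeasure_restrict]
      exact ((measure_mono hDK).trans_lt hK.measure_lt_top).ne
    infer_instance
  · exact QuotientMeasureEqMeasurePreimage.smulInvariantMeasure_quotient ν
  · rw [Measure.map_apply ‹_› MeasurableSet.univ]
    simp only [preimage_univ, Measure.restrict_apply_univ]
    exact fD.measure_ne_zero (Measure.measure_univ_ne_zero.1 (isOpen_univ.measure_ne_zero ν univ_nonempty))

/-! ### The spin group as a topological group without characters -/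

namespace SpinPlus13

open Topology

theorem isClosedEmbedding_toSL :
    IsClosedEmbedding fun g => (toSL g : Matrix (Fin 2) (Fin 2) ℂ) := by
  refine ⟨⟨isInducing_toSL, fun g h H => toSL_injective (Subtype.ext H)⟩, ?_⟩
  have : Set.range (fun g => (toSL g : Matrix (Fin 2) (Fin 2) ℂ)) = {A | A.det = 1} := by
    ext A
    constructor
    · rintro ⟨g, rfl⟩
      exact (toSL g).det_coe
    · intro hA
      obtain ⟨g, hg⟩ := toSL_surjective ⟨A, hA⟩
      exact ⟨g, congrArg Subtype.val hg⟩
  rw [this]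
  exact isClosed_eq (Continuous.matrix_det continuous_id) continuous_const

instance : IsTopologicalGroup SpinPlus13 :=
  topologicalGroup_of_lieGroup 𝓘(ℝ, ℂ × ℂ × ℂ) ∞

instance : PolishSpace (Matrix (Fin 2) (Fin 2) ℂ) := inferInstanceAs (PolishSpace (Fin 2 → Fin 2 → ℂ))

instance : LocallyCompactSpace (Matrix (Fin 2) (Fin 2) ℂ) :=
  inferInstanceAs (LocallyCompactSpace (Fin 2 → Fin 2 → ℂ))

instance : PolishSpace SpinPlus13 := isClosedEmbedding_toSL.polishSpace

instance : LocallyCompactSpace SpinPlus13 := isClosedEmbedding_toSL.locallyCompactSpace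

/-- `SL(2, ℂ)` is generated by transvections. -/
theorem closure_transvections :
    Subgroup.closure (Set.range upper ∪ Set.range lower) = ⊤ := by
  have hu (z : ℂ) : upper z ∈ Subgroup.closure (Set.range upper ∪ Set.range lower) :=
    Subgroup.subset_closure (Or.inl ⟨z, rfl⟩)
  have hl (z : ℂ) : lower z ∈ Subgroup.closure (Set.range upper ∪ Set.range lower) :=
    Subgroup.subset_closure (Or.inr ⟨z, rfl⟩)
  rw [eq_top_iff]
  have key (A : Matrix.SpecialLinearGroup (Fin 2) ℂ) (h : A 1 0 ≠ 0) :
      A ∈ Subgroup.closure (Set.range upper ∪ Set.range lower) := by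
    have hA : A = upper ((A 0 0 - 1) / A 1 0) * lower (A 1 0) * upper ((A 1 1 - 1) / A 1 0) := by
      have hd := A.det_coe
      rw [Matrix.det_fin_two] at hd
      apply Subtype.ext
      rw [Matrix.SpecialLinearGroup.coe_mul, Matrix.SpecialLinearGroup.coe_mul]
      ext i j
      fin_cases i <;> fin_cases j <;>
        simp [upper, lower] <;> field_simp
      all_goals first
        | linear_combination (-1) * hd
        | linear_combination hd
        | ring
    rw [hA]
    exact mul_mem (mul_mem (hu _) (hl _)) (hu _)
  intro A _
  by_cases h : A 1 0 = 0
  · have h0 : A 0 0 ≠ 0 := by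
      intro h0
      have hd := A.det_coe
      rw [Matrix.det_fin_two, h, h0] at hd
      simp at hd
    have h1 : (lower 1 * A) 1 0 ≠ 0 := by
      rw [Matrix.SpecialLinearGroup.coe_mul]
      simpa [lower, Matrix.vecMul, dotProduct, Fin.sum_univ_two, h] using h0
    exact (mul_mem_cancel_left (hl 1)).1 (key _ h1)
  · exact key A h

/-- The group has no non-trivial characters: conjugation by `diag(2, 1/2)` multiplies the parameter
of a transvection by `4` or `1/4`, so that every transvection is a commutator. -/
theorem monoidHom_eq_one {C : Type*} [CommMonoid C] (χ : SpinPlus13 →* C) (g : SpinPlus13) :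
    χ g = 1 := by
  let ψ : Matrix.SpecialLinearGroup (Fin 2) ℂ →* C := χ.comp equivSL.symm.toMonoidHom
  let t : Matrix.SpecialLinearGroup (Fin 2) ℂ := ⟨!![2, 0; 0, 1 / 2], by simp⟩
  -- The values of a character commute, so that it is trivial on commutators.
  have hcomm (a b : Matrix.SpecialLinearGroup (Fin 2) ℂ) : ψ (a * b * a⁻¹ * b⁻¹) = 1 := by
    have : ψ (a * b * a⁻¹ * b⁻¹) = ψ (a * a⁻¹) * ψ (b * b⁻¹) := by
      simp only [map_mul]
      ac_rfl
    simpa using this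
  have hψ : ψ = 1 := by
    refine MonoidHom.eq_of_eqOn_dense closure_transvections ?_
    rintro _ (⟨z, rfl⟩ | ⟨z, rfl⟩)
    · have : upper z = t * upper (z / 3) * t⁻¹ * (upper (z / 3))⁻¹ := by
        apply Subtype.ext
        simp only [Matrix.SpecialLinearGroup.coe_mul, Matrix.SpecialLinearGroup.coe_inv]
        ext i j
        fin_cases i <;> fin_cases j <;> simp [t, upper, Matrix.adjugate_fin_two]
        ring
      rw [this, hcomm]; rfl
    · have : lower z = t⁻¹ * lower (z / 3) * t⁻¹⁻¹ * (lower (z / 3))⁻¹ := by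
        apply Subtype.ext
        simp only [Matrix.SpecialLinearGroup.coe_mul, Matrix.SpecialLinearGroup.coe_inv]
        ext i j
        fin_cases i <;> fin_cases j <;> simp [t, lower, Matrix.adjugate_fin_two]
        ring
      rw [this, hcomm]; rfl
  have := DFunLike.congr_fun hψ (equivSL g)
  simpa [ψ] using this

open MeasureTheory in
/-- The group is unimodular, as it has no non-trivial characters. -/
theorem isMulRightInvariant_haar [MeasurableSpace SpinPlus13] [BorelSpace SpinPlus13]
    (ν : Measure SpinPlus13) [ν.IsHaarMeasure] : ν.IsMulRightInvariant where
  map_mul_right_eq_self g := by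
    rw [Measure.map_right_mul_eq_modularCharacterFun_smul ν g]
    have : Measure.modularCharacterFun g = 1 := monoidHom_eq_one Measure.modularCharacter g
    rw [this, one_smul]

end SpinPlus13

/-! ### A chart at the unit element -/

namespace SpinPlus13

open Topology

/-- The coordinates of the unit element in the chart `chartA`. -/
def base : ℂ × ℂ × ℂ := (1, 0, 0)

theorem entry_one (i j : Fin 2) : entry i j 1 = (1 : Matrix (Fin 2) (Fin 2) ℂ) i j := by
  simp [entry]

theorem chartA_apply (g : SpinPlus13) : chartA g = (entry 0 0 g, entry 0 1 g, entry 1 0 g) := rfl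

theorem chartA_one : chartA 1 = base := by
  simp [chartA_apply, entry_one, base]

theorem one_mem_source : (1 : SpinPlus13) ∈ chartA.source := by
  change entry 0 0 1 ≠ 0
  simp [entry_one]

theorem base_mem_target : base ∈ chartA.target := by
  rw [← chartA_one]
  exact chartA.map_source one_mem_source

theorem chartA_symm_base : chartA.symm base = 1 := by
  rw [← chartA_one]
  exact chartA.left_inv one_mem_source

theorem chartA_mem_maximalAtlas :
    chartA ∈ IsManifold.maximalAtlas 𝓘(ℝ, ℂ × ℂ × ℂ) ∞ SpinPlus13 :=
  IsManifold.subset_maximalAtlas (Or.inl rfl)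

theorem contMDiffAt_chartA {g : SpinPlus13} (hg : g ∈ chartA.source) :
    ContMDiffAt 𝓘(ℝ, ℂ × ℂ × ℂ) 𝓘(ℝ, ℂ × ℂ × ℂ) ∞ chartA g :=
  contMDiffAt_of_mem_maximalAtlas chartA_mem_maximalAtlas hg

theorem contMDiffAt_chartA_symm {z : ℂ × ℂ × ℂ} (hz : z ∈ chartA.target) :
    ContMDiffAt 𝓘(ℝ, ℂ × ℂ × ℂ) 𝓘(ℝ, ℂ × ℂ × ℂ) ∞ chartA.symm z :=
  contMDiffAt_symm_of_mem_maximalAtlas chartA_mem_maximalAtlas hz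

/-- If `f` is smooth and maps `x` into the domain of `chartA`, then near `x` it is recovered from
its coordinates. -/
theorem eventually_chartA_symm_chartA {X : Type*} [TopologicalSpace X] {f : X → SpinPlus13} {x : X}
    (hf : ContinuousAt f x) (hx : f x ∈ chartA.source) :
    ∀ᶠ w in 𝓝 x, chartA.symm (chartA (f w)) = f w := by
  filter_upwards [hf (chartA.open_source.mem_nhds hx)] with w hw
  exact chartA.left_inv hw

/-! ### Right-invariant vector fields and the adjoint representation -/

/-- The coordinates of the left translate of the point of coordinates `z` by the element of
coordinates `w`. -/
def coordMul (w z : ℂ × ℂ × ℂ) : ℂ × ℂ × ℂ := chartA (chartA.symm w * chartA.symm z)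

/-- The expression in the chart `chartA` of the right-invariant vector field `g ↦ ξ g`, for
the trace-free matrix `ξ` with entries `ξ₁, ξ₂; ξ₃, -ξ₁`. -/
def rightField (ξ z : ℂ × ℂ × ℂ) : ℂ × ℂ × ℂ :=
  (ξ.1 * z.1 + ξ.2.1 * z.2.2, ξ.1 * z.2.1 + ξ.2.1 * ((1 + z.2.1 * z.2.2) / z.1),
    ξ.2.2 * z.1 - ξ.1 * z.2.2)

theorem rightField_base (ξ : ℂ × ℂ × ℂ) : rightField ξ base = ξ := by
  simp [rightField, base]

theorem coordMul_eq {w z : ℂ × ℂ × ℂ} (hw : w ∈ chartA.target) (hz : z ∈ chartA.target) :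
    coordMul w z = (w.1 * z.1 + w.2.1 * z.2.2, w.1 * z.2.1 + w.2.1 * ((1 + z.2.1 * z.2.2) / z.1),
      w.2.2 * z.1 + (1 + w.2.1 * w.2.2) / w.1 * z.2.2) := by
  have hw' : w.1 ≠ 0 := hw
  have hz' : z.1 ≠ 0 := hz
  simp [coordMul, chartA_apply, entry_mul, entry_chartA_symm, hw', hz']

theorem coordMul_base {z : ℂ × ℂ × ℂ} (hz : z ∈ chartA.target) : coordMul base z = z := by
  rw [coordMul, chartA_symm_base, one_mul, chartA.right_inv hz]

theorem hasFDerivAt_inv_fst : HasFDerivAt (fun w : ℂ × ℂ × ℂ => (w.1)⁻¹)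
    (-(ContinuousLinearMap.fst ℝ ℂ (ℂ × ℂ))) base := by
  refine ((hasFDerivAt_inv' (𝕜 := ℝ) (x := base.1) (by simp [base])).comp base
    hasFDerivAt_fst).congr_fderiv ?_
  ext <;> simp [base]

theorem hasFDerivAt_coordMul {z : ℂ × ℂ × ℂ} (hz : z ∈ chartA.target) :
    ∃ L : (ℂ × ℂ × ℂ) →L[ℝ] (ℂ × ℂ × ℂ), HasFDerivAt (fun w => coordMul w z) L base ∧
      ∀ ξ, L ξ = rightField ξ z := by
  have h1 : HasFDerivAt (fun w : ℂ × ℂ × ℂ => w.1) (ContinuousLinearMap.fst ℝ ℂ (ℂ × ℂ)) base :=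
    hasFDerivAt_fst
  have h2 : HasFDerivAt (fun w : ℂ × ℂ × ℂ => w.2.1)
      ((ContinuousLinearMap.fst ℝ ℂ ℂ).comp (ContinuousLinearMap.snd ℝ ℂ (ℂ × ℂ))) base :=
    hasFDerivAt_fst.comp base hasFDerivAt_snd
  have h3 : HasFDerivAt (fun w : ℂ × ℂ × ℂ => w.2.2)
      ((ContinuousLinearMap.snd ℝ ℂ ℂ).comp (ContinuousLinearMap.snd ℝ ℂ (ℂ × ℂ))) base :=
    hasFDerivAt_snd.comp base hasFDerivAt_snd
  have hd := ((h2.mul h3).const_add 1).mul hasFDerivAt_inv_fst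
  have key := ((h1.mul_const z.1).add (h2.mul_const z.2.2)).prodMk
    (((h1.mul_const z.2.1).add (h2.mul_const ((1 + z.2.1 * z.2.2) / z.1))).prodMk
      ((h3.mul_const z.1).add (hd.mul_const z.2.2)))
  refine ⟨_, key.congr_of_eventuallyEq ?_, fun ξ => ?_⟩
  · filter_upwards [chartA.open_target.mem_nhds base_mem_target] with w hw
    rw [coordMul_eq hw hz]
    simp [div_eq_mul_inv]
  · simp [rightField, base, mul_comm]
    ring

/-- The conjugation by `g`, in the chart `chartA`. -/
def coordConj (g : SpinPlus13) (w : ℂ × ℂ × ℂ) : ℂ × ℂ × ℂ := chartA (g * chartA.symm w * g⁻¹)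

theorem contMDiffAt_conj (g : SpinPlus13) :
    ContMDiffAt 𝓘(ℝ, ℂ × ℂ × ℂ) 𝓘(ℝ, ℂ × ℂ × ℂ) ∞ (fun w => g * chartA.symm w * g⁻¹) base :=
  (contMDiffAt_const.mul (contMDiffAt_chartA_symm base_mem_target)).mul contMDiffAt_const

theorem conj_base (g : SpinPlus13) : g * chartA.symm base * g⁻¹ = 1 := by
  simp [chartA_symm_base]

theorem coordConj_base (g : SpinPlus13) : coordConj g base = base := by
  rw [coordConj, conj_base, chartA_one]

theorem eventually_chartA_symm_coordConj (g : SpinPlus13) :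
    ∀ᶠ w in 𝓝 base, chartA.symm (coordConj g w) = g * chartA.symm w * g⁻¹ :=
  eventually_chartA_symm_chartA (contMDiffAt_conj g).continuousAt (by
    rw [conj_base]; exact one_mem_source)

theorem differentiableAt_coordConj (g : SpinPlus13) : DifferentiableAt ℝ (coordConj g) base := by
  have h : ContMDiffAt 𝓘(ℝ, ℂ × ℂ × ℂ) 𝓘(ℝ, ℂ × ℂ × ℂ) ∞ (coordConj g) base :=
    ContMDiffAt.comp base (contMDiffAt_chartA (by rw [conj_base]; exact one_mem_source))
      (contMDiffAt_conj g)
  exact h.contDiffAt.differentiableAt (by simp)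

/-- The adjoint representation, on the coordinates of the Lie algebra. -/
def Ad : SpinPlus13 →* ((ℂ × ℂ × ℂ) →L[ℝ] (ℂ × ℂ × ℂ)) where
  toFun g := fderiv ℝ (coordConj g) base
  map_one' := by
    have : coordConj 1 =ᶠ[𝓝 base] id := by
      filter_upwards [chartA.open_target.mem_nhds base_mem_target] with w hw
      simp [coordConj, chartA.right_inv hw]
    rw [this.fderiv_eq, fderiv_id]
    rfl
  map_mul' g k := by
    have : coordConj (g * k) =ᶠ[𝓝 base] coordConj g ∘ coordConj k := by
      filter_upwards [eventually_chartA_symm_coordConj k] with w hw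
      simp only [Function.comp, coordConj] at hw ⊢
      rw [hw]
      congr 1
      group
    rw [this.fderiv_eq, fderiv_comp, coordConj_base]
    · rfl
    · rw [coordConj_base]; exact differentiableAt_coordConj g
    · exact differentiableAt_coordConj k

/-- The adjoint representation is unimodular, as there are no non-trivial characters. -/
theorem det_Ad (g : SpinPlus13) : LinearMap.det (Ad g : (ℂ × ℂ × ℂ) →ₗ[ℝ] (ℂ × ℂ × ℂ)) = 1 := by
  let χ : SpinPlus13 →* ℝ :=
    { toFun g := LinearMap.det (Ad g : (ℂ × ℂ × ℂ) →ₗ[ℝ] (ℂ × ℂ × ℂ))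
      map_one' := by rw [map_one]; exact LinearMap.det_id
      map_mul' g k := by rw [map_mul, ← LinearMap.det_comp]; rfl }
  exact monoidHom_eq_one χ g

end SpinPlus13

/-! ### Infinitesimal generators of the action -/

namespace SpinPlus13

open Topology

variable {F : Type*} [NormedAddCommGroup F] [NormedSpace ℝ F]
  {M : Type*} [TopologicalSpace M] [ChartedSpace F M] [MulAction SpinPlus13 M]

variable (F) in
/-- The value at `y` of the vector fields on `M` that generate the action of the group, as a linear
function of the element of the Lie algebra. -/
def generator (y : M) : (ℂ × ℂ × ℂ) →L[ℝ] F :=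
  mfderiv 𝓘(ℝ, ℂ × ℂ × ℂ) 𝓘(ℝ, F) (fun w => chartA.symm w • y) base

variable [ContMDiffSMul 𝓘(ℝ, ℂ × ℂ × ℂ) 𝓘(ℝ, F) ∞ SpinPlus13 M]

variable (F) in
theorem contMDiff_orbitMap (y : M) :
    ContMDiff 𝓘(ℝ, ℂ × ℂ × ℂ) 𝓘(ℝ, F) ∞ (fun h : SpinPlus13 => h • y) :=
  (ContMDiffSMul.contMDiff_smul (I := 𝓘(ℝ, ℂ × ℂ × ℂ)) (I' := 𝓘(ℝ, F)) (n := ∞)).comp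
    (contMDiff_id.prodMk contMDiff_const)

variable (F) in
theorem contMDiff_smul_left (g : SpinPlus13) :
    ContMDiff 𝓘(ℝ, F) 𝓘(ℝ, F) ∞ (fun y : M => g • y) :=
  (ContMDiffSMul.contMDiff_smul (I := 𝓘(ℝ, ℂ × ℂ × ℂ)) (I' := 𝓘(ℝ, F)) (n := ∞)).comp
    (contMDiff_const.prodMk contMDiff_id)

variable (F) in
theorem contMDiffAt_chartA_symm_smul (y : M) {z : ℂ × ℂ × ℂ} (hz : z ∈ chartA.target) :
    ContMDiffAt 𝓘(ℝ, ℂ × ℂ × ℂ) 𝓘(ℝ, F) ∞ (fun w => chartA.symm w • y) z :=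
  (contMDiff_orbitMap F y).contMDiffAt.comp z (contMDiffAt_chartA_symm hz)

variable (F) in
theorem hasMFDerivAt_generator (y : M) :
    HasMFDerivAt 𝓘(ℝ, ℂ × ℂ × ℂ) 𝓘(ℝ, F) (fun w => chartA.symm w • y) base (generator F y) :=
  ((contMDiffAt_chartA_symm_smul F y base_mem_target).mdifferentiableAt (by simp)).hasMFDerivAt

/-- In the coordinates `w ↦ chartA.symm w • y` of an orbit, the generators of the action are
the right-invariant vector fields. -/
theorem mfderiv_chartA_symm_smul_rightField (y : M) {z : ℂ × ℂ × ℂ} (hz : z ∈ chartA.target)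
    (ξ : ℂ × ℂ × ℂ) :
    mfderiv 𝓘(ℝ, ℂ × ℂ × ℂ) 𝓘(ℝ, F) (fun w => chartA.symm w • y) z (rightField ξ z)
      = generator F (chartA.symm z • y) ξ := by
  obtain ⟨L, hL, hLξ⟩ := hasFDerivAt_coordMul hz
  have h1 : HasMFDerivAt 𝓘(ℝ, ℂ × ℂ × ℂ) 𝓘(ℝ, F) (fun w => chartA.symm w • y) (coordMul base z)
      (mfderiv 𝓘(ℝ, ℂ × ℂ × ℂ) 𝓘(ℝ, F) (fun w => chartA.symm w • y) z) := by
    rw [coordMul_base hz]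
    exact ((contMDiffAt_chartA_symm_smul F y hz).mdifferentiableAt (by simp)).hasMFDerivAt
  have h2 := HasMFDerivAt.comp base h1 hL.hasMFDerivAt
  have h3 := (hasMFDerivAt_generator F (chartA.symm z • y))
  have hev : (fun w => chartA.symm w • chartA.symm z • y) =ᶠ[𝓝 base]
      (fun w => chartA.symm w • y) ∘ fun w => coordMul w z := by
    have hc : ContinuousAt (fun w => chartA.symm w * chartA.symm z) base :=
      (contMDiffAt_chartA_symm base_mem_target).continuousAt.mul continuousAt_const
    filter_upwards [eventually_chartA_symm_chartA hc (by
      rw [chartA_symm_base, one_mul]; exact chartA.map_target hz)] with w hw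
    simp only [Function.comp, coordMul]
    rw [hw, mul_smul]
  have h4 := hasMFDerivAt_unique h3 (h2.congr_of_eventuallyEq hev)
  rw [← hLξ]
  exact (DFunLike.congr_fun h4 ξ).symm

/-- The tangent space of an orbit is spanned by the generators of the action. -/
theorem mem_orbitTangentSpace_iff (x : M) (g : SpinPlus13) (v : F) :
    v ∈ orbitTangentSpace F x g ↔ ∃ ξ, generator F (g • x) ξ = v := by
  have h0 : HasMFDerivAt 𝓘(ℝ, ℂ × ℂ × ℂ) 𝓘(ℝ, F) (fun h : SpinPlus13 => h • x) g
      (mfderiv 𝓘(ℝ, ℂ × ℂ × ℂ) 𝓘(ℝ, F) (fun h : SpinPlus13 => h • x) g) :=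
    ((contMDiff_orbitMap F x).contMDiffAt.mdifferentiableAt (by simp)).hasMFDerivAt
  constructor
  · rintro ⟨w, rfl⟩
    have hs : g * g⁻¹ ∈ chartA.source := by
      rw [mul_inv_cancel]; exact one_mem_source
    have hm : ContMDiffAt 𝓘(ℝ, ℂ × ℂ × ℂ) 𝓘(ℝ, ℂ × ℂ × ℂ) ∞ (fun h => chartA (h * g⁻¹)) g :=
      ContMDiffAt.comp g (contMDiffAt_chartA hs) (contMDiffAt_id.mul contMDiffAt_const)
    have h1 := (hm.mdifferentiableAt (by simp)).hasMFDerivAt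
    have h2 : HasMFDerivAt 𝓘(ℝ, ℂ × ℂ × ℂ) 𝓘(ℝ, F) (fun w => chartA.symm w • g • x)
        (chartA (g * g⁻¹)) (generator F (g • x)) := by
      rw [mul_inv_cancel, chartA_one]
      exact hasMFDerivAt_generator F (g • x)
    have h3 := HasMFDerivAt.comp g h2 h1
    have hev : (fun h : SpinPlus13 => h • x) =ᶠ[𝓝 g]
        (fun w => chartA.symm w • g • x) ∘ fun h => chartA (h * g⁻¹) := by
      filter_upwards [eventually_chartA_symm_chartA (f := fun h => h * g⁻¹) (by fun_prop) hs] with h hh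
      simp only [Function.comp, hh]
      simp [← mul_smul]
    have h4 := hasMFDerivAt_unique h0 (h3.congr_of_eventuallyEq hev)
    exact ⟨_, (DFunLike.congr_fun h4 w).symm⟩
  · rintro ⟨ξ, rfl⟩
    have hm : ContMDiffAt 𝓘(ℝ, ℂ × ℂ × ℂ) 𝓘(ℝ, ℂ × ℂ × ℂ) ∞ (fun w => chartA.symm w * g) base :=
      (contMDiffAt_chartA_symm base_mem_target).mul contMDiffAt_const
    have h1 := (hm.mdifferentiableAt (by simp)).hasMFDerivAt
    have h0' : HasMFDerivAt 𝓘(ℝ, ℂ × ℂ × ℂ) 𝓘(ℝ, F) (fun h : SpinPlus13 => h • x)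
      (chartA.symm base * g)
      (mfderiv 𝓘(ℝ, ℂ × ℂ × ℂ) 𝓘(ℝ, F) (fun h : SpinPlus13 => h • x) g) := by
      rw [chartA_symm_base, one_mul]; exact h0
    have h3 := HasMFDerivAt.comp base h0' h1
    have hfun : (fun h : SpinPlus13 => h • x) ∘ (fun w => chartA.symm w * g)
        = fun w => chartA.symm w • g • x := by
      funext w; simp [mul_smul]
    rw [hfun] at h3
    have h4 := hasMFDerivAt_unique (hasMFDerivAt_generator F (g • x)) h3
    exact ⟨_, (DFunLike.congr_fun h4 ξ).symm⟩

/-- The generators of the action are permuted by the group, through the adjoint representation. -/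
theorem generator_smul (g : SpinPlus13) (y : M) (ξ : ℂ × ℂ × ℂ) :
    generator F (g • y) ξ
      = mfderiv 𝓘(ℝ, F) 𝓘(ℝ, F) (fun m : M => g • m) y (generator F y (Ad g⁻¹ ξ)) := by
  have h1 : HasMFDerivAt 𝓘(ℝ, ℂ × ℂ × ℂ) 𝓘(ℝ, ℂ × ℂ × ℂ) (coordConj g⁻¹) base (Ad g⁻¹) :=
    (differentiableAt_coordConj g⁻¹).hasFDerivAt.hasMFDerivAt
  have h2 : HasMFDerivAt 𝓘(ℝ, ℂ × ℂ × ℂ) 𝓘(ℝ, F) (fun w => chartA.symm w • y) (coordConj g⁻¹ base)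
      (generator F y) := by
    rw [coordConj_base]; exact hasMFDerivAt_generator F y
  have h3 := HasMFDerivAt.comp base h2 h1
  have h4 : HasMFDerivAt 𝓘(ℝ, F) 𝓘(ℝ, F) (fun m : M => g • m)
      (((fun w => chartA.symm w • y) ∘ coordConj g⁻¹) base)
      (mfderiv 𝓘(ℝ, F) 𝓘(ℝ, F) (fun m : M => g • m) y) := by
    have hy : ((fun w => chartA.symm w • y) ∘ coordConj g⁻¹) base = y := by
      simp [coordConj_base, chartA_symm_base]
    rw [hy]
    exact ((contMDiff_smul_left F (M := M) g).contMDiffAt.mdifferentiableAt (by simp)).hasMFDerivAt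
  have h5 := HasMFDerivAt.comp base h4 h3
  have hev : (fun w => chartA.symm w • g • y) =ᶠ[𝓝 base]
      (fun m : M => g • m) ∘ ((fun w => chartA.symm w • y) ∘ coordConj g⁻¹) := by
    filter_upwards [eventually_chartA_symm_coordConj g⁻¹] with w hw
    simp only [Function.comp, hw, ← mul_smul]
    congr 1
    group
  have h6 := hasMFDerivAt_unique (hasMFDerivAt_generator F (g • y)) (h5.congr_of_eventuallyEq hev)
  exact DFunLike.congr_fun h6 ξ

end SpinPlus13

namespace SpinPlus13

open Topology

/-! ### The exterior derivative in a frame of right-invariant vector fields -/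

/-- The coordinates of the Pauli matrices `σ₁, σ₂, σ₃` and of `iσ₁, iσ₂, iσ₃`, which form a real
basis of the Lie algebra. -/
def pauli : Fin 6 → ℂ × ℂ × ℂ :=
  ![(0, 1, 1), (0, -Complex.I, Complex.I), (1, 0, 0),
    (0, Complex.I, Complex.I), (0, 1, -1), (Complex.I, 0, 0)]

theorem hasFDerivAt_rightField (ξ : ℂ × ℂ × ℂ) :
    ∃ L : (ℂ × ℂ × ℂ) →L[ℝ] (ℂ × ℂ × ℂ), HasFDerivAt (rightField ξ) L base ∧
      ∀ η, L η = (ξ.1 * η.1 + ξ.2.1 * η.2.2, ξ.1 * η.2.1 - ξ.2.1 * η.1,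
        ξ.2.2 * η.1 - ξ.1 * η.2.2) := by
  have h1 : HasFDerivAt (fun w : ℂ × ℂ × ℂ => w.1) (ContinuousLinearMap.fst ℝ ℂ (ℂ × ℂ)) base :=
    hasFDerivAt_fst
  have h2 : HasFDerivAt (fun w : ℂ × ℂ × ℂ => w.2.1)
      ((ContinuousLinearMap.fst ℝ ℂ ℂ).comp (ContinuousLinearMap.snd ℝ ℂ (ℂ × ℂ))) base :=
    hasFDerivAt_fst.comp base hasFDerivAt_snd
  have h3 : HasFDerivAt (fun w : ℂ × ℂ × ℂ => w.2.2)
      ((ContinuousLinearMap.snd ℝ ℂ ℂ).comp (ContinuousLinearMap.snd ℝ ℂ (ℂ × ℂ))) base :=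
    hasFDerivAt_snd.comp base hasFDerivAt_snd
  have hd := ((h2.mul h3).const_add 1).mul hasFDerivAt_inv_fst
  have key := ((h1.const_mul ξ.1).add (h3.const_mul ξ.2.1)).prodMk
    (((h2.const_mul ξ.1).add (hd.const_mul ξ.2.1)).prodMk
      ((h1.const_mul ξ.2.2).sub (h3.const_mul ξ.1)))
  refine ⟨_, key.congr_of_eventuallyEq (Filter.Eventually.of_forall fun w => ?_), fun η => ?_⟩
  · simp [rightField, div_eq_mul_inv]
  · simp [base]
    ring

theorem contDiffAt_rightField (ξ : ℂ × ℂ × ℂ) {z : ℂ × ℂ × ℂ} (hz : z ∈ chartA.target) :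
    ContDiffAt ℝ ∞ (rightField ξ) z := by
  have hz' : z.1 ≠ 0 := hz
  unfold rightField
  simp only [div_eq_mul_inv]
  refine ContDiffAt.prodMk (by fun_prop) (ContDiffAt.prodMk ?_ (by fun_prop))
  exact ContDiffAt.add (by fun_prop) (ContDiffAt.mul (by fun_prop)
    (ContDiffAt.mul (by fun_prop) (ContDiffAt.inv (by fun_prop) hz')))

theorem lieBracket_rightField (ξ η : ℂ × ℂ × ℂ) :
    VectorField.lieBracket ℝ (rightField ξ) (rightField η) base
      = (η.2.1 * ξ.2.2 - ξ.2.1 * η.2.2, 2 * (η.1 * ξ.2.1 - ξ.1 * η.2.1),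
        2 * (ξ.1 * η.2.2 - η.1 * ξ.2.2)) := by
  obtain ⟨L, hL, hL'⟩ := hasFDerivAt_rightField ξ
  obtain ⟨K, hK, hK'⟩ := hasFDerivAt_rightField η
  rw [VectorField.lieBracket, hL.fderiv, hK.fderiv, rightField_base, rightField_base, hL', hK']
  ext <;> simp <;> ring

/-- The bracket of two Pauli matrices is a multiple of a third one. -/
theorem exists_lieBracket_pauli (i j : Fin 6) (h : i < j) : ∃ (r : ℝ) (k : Fin 6), k ≠ i ∧ k ≠ j ∧
    VectorField.lieBracket ℝ (rightField (pauli i)) (rightField (pauli j)) base = r • pauli k := by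
  have key (i j k : Fin 6) (r : ℝ) (hi : k ≠ i) (hj : k ≠ j) (hr : _ = r • pauli k) :
      ∃ (r : ℝ) (k : Fin 6), k ≠ i ∧ k ≠ j ∧
        VectorField.lieBracket ℝ (rightField (pauli i)) (rightField (pauli j)) base = r • pauli k :=
    ⟨r, k, hi, hj, (lieBracket_rightField _ _).trans hr⟩
  have hlist (P : Fin 6 → Fin 6 → Prop) (h01 : P 0 1) (h02 : P 0 2) (h03 : P 0 3) (h04 : P 0 4)
      (h05 : P 0 5) (h12 : P 1 2) (h13 : P 1 3) (h14 : P 1 4) (h15 : P 1 5) (h23 : P 2 3)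
      (h24 : P 2 4) (h25 : P 2 5) (h34 : P 3 4) (h35 : P 3 5) (h45 : P 4 5) :
      ∀ i j, i < j → P i j := by
    intro i j hij
    fin_cases i <;> fin_cases j <;> first | assumption | exact absurd hij (by decide)
  revert i j
  apply hlist
  · exact key 0 1 5 (-2) (by decide) (by decide) (by ext <;> simp [pauli]; ring)
  · exact key 0 2 4 2 (by decide) (by decide) (by ext <;> simp [pauli])
  · exact key 0 3 1 0 (by decide) (by decide) (by ext <;> simp [pauli])
  · exact key 0 4 2 2 (by decide) (by decide) (by ext <;> simp [pauli]; ring)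
  · exact key 0 5 1 (-2) (by decide) (by decide) (by ext <;> simp [pauli])
  · exact key 1 2 3 (-2) (by decide) (by decide) (by ext <;> simp [pauli])
  · exact key 1 3 2 (-2) (by decide) (by decide) (by ext <;> simp [pauli]; ring)
  · exact key 1 4 0 0 (by decide) (by decide) (by ext <;> simp [pauli])
  · exact key 1 5 0 2 (by decide) (by decide) (by ext <;> simp [pauli])
  · exact key 2 3 1 2 (by decide) (by decide) (by ext <;> simp [pauli])
  · exact key 2 4 0 (-2) (by decide) (by decide) (by ext <;> simp [pauli])
  · exact key 2 5 0 0 (by decide) (by decide) (by ext <;> simp [pauli])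
  · exact key 3 4 5 2 (by decide) (by decide) (by ext <;> simp [pauli]; ring)
  · exact key 3 5 4 (-2) (by decide) (by decide) (by ext <;> simp [pauli])
  · exact key 4 5 3 2 (by decide) (by decide) (by ext <;> simp [pauli])

open Matrix in
/-- In the frame of right-invariant vector fields given by the Pauli matrices, the exterior
derivative of a `5`-form has no bracket terms: the bracket of two fields of the frame is a multiple
of one of the four other fields, to which the form is applied too. -/
theorem extDeriv_pauli {p : ℂ × ℂ × ℂ → (ℂ × ℂ × ℂ) [⋀^Fin 5]→L[ℝ] ℝ}
    (hp : DifferentiableAt ℝ p base) :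
    extDeriv p base pauli = ∑ i : Fin 6, (-1) ^ i.val •
      fderiv ℝ (fun z => p z (fun j => rightField (i.removeNth pauli j) z)) base (pauli i) := by
  have h := extDeriv_apply_vectorField hp (V := fun i => rightField (pauli i))
    (fun i => (contDiffAt_rightField _ base_mem_target).differentiableAt (by simp))
  simp only [rightField_base] at h
  rw [h, sub_eq_self.2]
  · rfl
  · refine Finset.sum_eq_zero fun i _ => Finset.sum_eq_zero fun j hj => ?_
    -- The bracket of the fields `i` and `j + 1` is a multiple of the field `k`, which also stands
    -- among the other arguments, at the place `l`.
    have hij : i ≤ j := by simpa using hj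
    obtain ⟨r, k, hki, hkj, hk⟩ := exists_lieBracket_pauli i.castSucc j.succ
      (Fin.castSucc_lt_succ_iff.2 hij)
    obtain ⟨m, hm⟩ := Fin.exists_succAbove_eq hki
    have hmj : m ≠ j := by
      rintro rfl
      rw [Fin.succAbove_castSucc_of_le _ _ hij] at hm
      exact hkj hm.symm
    obtain ⟨l, hl⟩ := Fin.exists_succAbove_eq hmj
    rw [hk, ContinuousAlternatingMap.vecCons_smul,
      ContinuousAlternatingMap.map_eq_zero_of_eq _ _ (i := 0) (j := l.succ) _ (Fin.succ_ne_zero l).symm,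
      smul_zero, smul_zero]
    simp [Fin.removeNth, hl, hm]

end SpinPlus13

/-! ### Pullback of forms to the group by the orbit maps -/

/-- The evaluation of alternating forms on vectors is smooth. -/
theorem ContDiffAt.continuousAlternatingMap_apply {E F : Type*} [NormedAddCommGroup E]
    [NormedSpace ℝ E] [NormedAddCommGroup F] [NormedSpace ℝ F] {k : ℕ} {n : WithTop ℕ∞}
    {f : E → F [⋀^Fin k]→L[ℝ] ℝ} {v : Fin k → E → F} {x : E} (hf : ContDiffAt ℝ n f x)
    (hv : ∀ i, ContDiffAt ℝ n (v i) x) : ContDiffAt ℝ n (fun y => f y (fun i => v i y)) x := by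
  have h := ((ContinuousAlternatingMap.toContinuousMultilinearMapCLM ℝ :
    (F [⋀^Fin k]→L[ℝ] ℝ) →L[ℝ] _).analyticAt_uncurry_of_multilinear
      (x := (f x, fun i => v i x))).contDiffAt (n := n)
  exact h.comp x (hf.prodMk (contDiffAt_pi.2 hv))

namespace SpinPlus13

open Topology

variable {F : Type*} [NormedAddCommGroup F] [NormedSpace ℝ F]
  {M : Type*} [TopologicalSpace M] [ChartedSpace F M] [MulAction SpinPlus13 M] {k : ℕ}

/-- The value of a form at `y` on generators of the action. -/
def orbitCoeff (θ : FormField F M k) (η : Fin k → ℂ × ℂ × ℂ) (y : M) : ℝ :=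
  (θ y : F [⋀^Fin k]→L[ℝ] ℝ) (fun j => generator F y (η j))

variable (F) in
/-- The orbit map of `y`, in the chart `chartA` of the group and the preferred chart of `M` at `y`. -/
def orbitChart (y : M) (w : ℂ × ℂ × ℂ) : F := extChartAt 𝓘(ℝ, F) y (chartA.symm w • y)

/-- The pullback of a form to the group by the orbit map of `y`, in the chart `chartA`. -/
def orbitPullback (θ : FormField F M k) (y : M) (w : ℂ × ℂ × ℂ) : (ℂ × ℂ × ℂ) [⋀^Fin k]→L[ℝ] ℝ :=
  (θ.inChart y (orbitChart F y w)).compContinuousLinearMap (fderiv ℝ (orbitChart F y) w)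

variable (F) in
theorem orbitChart_base (y : M) : orbitChart F y base = extChartAt 𝓘(ℝ, F) y y := by
  rw [orbitChart, chartA_symm_base, one_smul]

variable [ContMDiffSMul 𝓘(ℝ, ℂ × ℂ × ℂ) 𝓘(ℝ, F) ∞ SpinPlus13 M]

variable (F) in
/-- Near the origin, the orbit map stays in the charts. -/
theorem eventually_smul_mem_source (y : M) : ∀ᶠ w in 𝓝 base,
    w ∈ chartA.target ∧ chartA.symm w • y ∈ (extChartAt 𝓘(ℝ, F) y).source := by
  refine Filter.Eventually.and (chartA.open_target.mem_nhds base_mem_target) ?_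
  have hc := (contMDiffAt_chartA_symm_smul F y base_mem_target).continuousAt
  refine hc ?_
  simp only [chartA_symm_base, one_smul]
  exact extChartAt_source_mem_nhds (I := 𝓘(ℝ, F)) y

variable [IsManifold 𝓘(ℝ, F) ∞ M]

theorem contDiffAt_orbitChart {y : M} {w : ℂ × ℂ × ℂ} (hw : w ∈ chartA.target)
    (hw' : chartA.symm w • y ∈ (extChartAt 𝓘(ℝ, F) y).source) :
    ContDiffAt ℝ ∞ (orbitChart F y) w := by
  have h : ContMDiffAt 𝓘(ℝ, ℂ × ℂ × ℂ) 𝓘(ℝ, F) ∞ (orbitChart F y) w :=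
    ContMDiffAt.comp w (contMDiffAt_extChartAt' (by rwa [← extChartAt_source 𝓘(ℝ, F)]))
      (contMDiffAt_chartA_symm_smul F y hw)
  exact h.contDiffAt

/-- The pullback of a form evaluated on right-invariant fields is the form evaluated on
generators. -/
theorem orbitPullback_rightField (θ : FormField F M k) (η : Fin k → ℂ × ℂ × ℂ) {y : M}
    {w : ℂ × ℂ × ℂ} (hw : w ∈ chartA.target)
    (hw' : chartA.symm w • y ∈ (extChartAt 𝓘(ℝ, F) y).source) :
    orbitPullback θ y w (fun j => rightField (η j) w) = orbitCoeff θ η (chartA.symm w • y) := by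
  have hinv : (extChartAt 𝓘(ℝ, F) y).symm (orbitChart F y w) = chartA.symm w • y :=
    (extChartAt 𝓘(ℝ, F) y).left_inv hw'
  have hmem : orbitChart F y w ∈ (extChartAt 𝓘(ℝ, F) y).target :=
    (extChartAt 𝓘(ℝ, F) y).map_source hw'
  have h1 := ((contDiffAt_orbitChart hw hw').differentiableAt (by simp)).hasFDerivAt.hasMFDerivAt
  have h2 := (((contMDiffOn_extChartAt_symm (I := 𝓘(ℝ, F)) (n := ∞) y).contMDiffAt
    ((isOpen_extChartAt_target y).mem_nhds hmem)).mdifferentiableAt (by simp)).hasMFDerivAt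
  have h3 := HasMFDerivAt.comp w h2 h1
  have h4 := ((contMDiffAt_chartA_symm_smul F y hw).mdifferentiableAt (by simp)).hasMFDerivAt
  have hc := (contMDiffAt_chartA_symm_smul F y hw).continuousAt
  have hev : (fun w => chartA.symm w • y) =ᶠ[𝓝 w]
      (extChartAt 𝓘(ℝ, F) y).symm ∘ orbitChart F y := by
    filter_upwards [hc ((isOpen_extChartAt_source (I := 𝓘(ℝ, F)) y).mem_nhds hw')] with v hv
    exact ((extChartAt 𝓘(ℝ, F) y).left_inv hv).symm
  have h5 := hasMFDerivAt_unique h4 (h3.congr_of_eventuallyEq hev)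
  have h6 (j : Fin k) : generator F (chartA.symm w • y) (η j)
      = mfderiv 𝓘(ℝ, F) 𝓘(ℝ, F) (extChartAt 𝓘(ℝ, F) y).symm (orbitChart F y w)
          (fderiv ℝ (orbitChart F y) w (rightField (η j) w)) := by
    rw [← mfderiv_chartA_symm_smul_rightField y hw]
    exact DFunLike.congr_fun h5 (rightField (η j) w)
  -- `hinv` cannot be used to rewrite: the tangent spaces at the two points are distinct types.
  have key (z z' : M) (hz : z = z') (v : Fin k → F) :
      (θ z : F [⋀^Fin k]→L[ℝ] ℝ) v = (θ z' : F [⋀^Fin k]→L[ℝ] ℝ) v := by subst hz; rfl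
  rw [orbitCoeff]
  simp only [h6]
  exact key _ _ hinv _

/-- The coefficient of a smooth form on generators is a smooth function along each orbit. -/
theorem contDiffAt_orbitCoeff {θ : FormField F M k} (hθ : θ.IsSmooth) (η : Fin k → ℂ × ℂ × ℂ)
    (y : M) : ContDiffAt ℝ ∞ (fun w => orbitCoeff θ η (chartA.symm w • y)) base := by
  have hev := eventually_smul_mem_source F y
  obtain ⟨hb, hb'⟩ := hev.self_of_nhds
  have hu := contDiffAt_orbitChart hb hb'
  have hmem : orbitChart F y base ∈ (extChartAt 𝓘(ℝ, F) y).target :=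
    (extChartAt 𝓘(ℝ, F) y).map_source hb'
  have hθ' : ContDiffAt ℝ ∞ (θ.inChart y) (orbitChart F y base) :=
    (hθ y).contDiffAt ((isOpen_extChartAt_target y).mem_nhds hmem)
  have hv (j : Fin k) : ContDiffAt ℝ ∞
      (fun w => fderiv ℝ (orbitChart F y) w (rightField (η j) w)) base :=
    (hu.fderiv_right (by simp)).clm_apply (contDiffAt_rightField (η j) hb)
  refine ((hθ'.comp base hu).continuousAlternatingMap_apply hv).congr_of_eventuallyEq ?_
  filter_upwards [hev] with w hw
  exact (orbitPullback_rightField θ η hw.1 hw.2).symm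

theorem differentiableAt_orbitPullback {θ : FormField F M k} (hθ : θ.IsSmooth) (y : M) :
    DifferentiableAt ℝ (orbitPullback θ y) base := by
  obtain ⟨hb, hb'⟩ := (eventually_smul_mem_source F y).self_of_nhds
  have hu := contDiffAt_orbitChart hb hb'
  have hmem : orbitChart F y base ∈ (extChartAt 𝓘(ℝ, F) y).target :=
    (extChartAt 𝓘(ℝ, F) y).map_source hb'
  have hθ' : ContDiffAt ℝ ∞ (θ.inChart y) (orbitChart F y base) :=
    (hθ y).contDiffAt ((isOpen_extChartAt_target y).mem_nhds hmem)
  exact ((hθ'.comp base hu).differentiableAt (by simp)).continuousAlternatingMapCompContinuousLinearMap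
    ((hu.fderiv_right (m := ∞) (by simp)).differentiableAt (by simp))

/-- The exterior derivative commutes with the pullback to the group. -/
theorem extDeriv_orbitPullback {θ : FormField F M k} (hθ : θ.IsSmooth) (η : Fin (k + 1) → ℂ × ℂ × ℂ)
    (y : M) : extDeriv (orbitPullback θ y) base η = orbitCoeff θ.d η y := by
  obtain ⟨hb, hb'⟩ := (eventually_smul_mem_source F y).self_of_nhds
  have hu := contDiffAt_orbitChart hb hb'
  have hmem : orbitChart F y base ∈ (extChartAt 𝓘(ℝ, F) y).target :=
    (extChartAt 𝓘(ℝ, F) y).map_source hb'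
  have hθ' : ContDiffAt ℝ ∞ (θ.inChart y) (orbitChart F y base) :=
    (hθ y).contDiffAt ((isOpen_extChartAt_target y).mem_nhds hmem)
  have h1 : extDeriv (orbitPullback θ y) base = _ :=
    extDeriv_pullback (hθ'.differentiableAt (by simp)) hu (by simpa using ENat.LEInfty.out)
  have h2 : HasMFDerivAt 𝓘(ℝ, F) 𝓘(ℝ, F) (extChartAt 𝓘(ℝ, F) y) (chartA.symm base • y)
      (mfderiv 𝓘(ℝ, F) 𝓘(ℝ, F) (extChartAt 𝓘(ℝ, F) y) y) := by
    rw [chartA_symm_base, one_smul]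
    exact (mdifferentiableAt_extChartAt (mem_chart_source F y)).hasMFDerivAt
  have h3 := HasMFDerivAt.comp base h2 (hasMFDerivAt_generator F y)
  have h4 := hasMFDerivAt_unique (hu.differentiableAt (by simp)).hasFDerivAt.hasMFDerivAt h3
  have h5 (j : Fin (k + 1)) : fderiv ℝ (orbitChart F y) base (η j)
      = mfderiv 𝓘(ℝ, F) 𝓘(ℝ, F) (extChartAt 𝓘(ℝ, F) y) y (generator F y (η j)) :=
    DFunLike.congr_fun h4 (η j)
  rw [h1, orbitChart_base]
  change extDeriv (θ.inChart y) (extChartAt 𝓘(ℝ, F) y y)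
    (fun j => fderiv ℝ (orbitChart F y) base (η j)) = _
  simp only [h5]
  rfl

/-- In the frame of the generators, the exterior derivative of a `5`-form along an orbit is a sum
of derivatives of its coefficients, as in a commuting frame. -/
theorem orbitCoeff_d {P : FormField F M 5} (hP : P.IsSmooth) (y : M) :
    orbitCoeff P.d pauli y = ∑ i : Fin 6, (-1) ^ i.val •
      fderiv ℝ (fun w => orbitCoeff P (i.removeNth pauli) (chartA.symm w • y)) base (pauli i) := by
  rw [← extDeriv_orbitPullback hP, extDeriv_pauli (differentiableAt_orbitPullback hP y)]
  refine Finset.sum_congr rfl fun i _ => ?_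
  congr 2
  refine Filter.EventuallyEq.fderiv_eq ?_
  filter_upwards [eventually_smul_mem_source F y] with w hw
  exact orbitPullback_rightField P (i.removeNth pauli) hw.1 hw.2

end SpinPlus13

namespace SpinPlus13

open Topology MeasureTheory Set

/-! ### Integration over a compact quotient by a discrete subgroup -/

/-- A function on the group is smooth if its right translates are smooth at the origin of the
chart `chartA`. -/
theorem contMDiff_of_contDiffAt_base {Φ : SpinPlus13 → ℝ}
    (h : ∀ g, ContDiffAt ℝ ∞ (fun w => Φ (chartA.symm w * g)) base) :
    ContMDiff 𝓘(ℝ, ℂ × ℂ × ℂ) 𝓘(ℝ, ℝ) ∞ Φ := by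
  intro g
  have hs : g * g⁻¹ ∈ chartA.source := by
    rw [mul_inv_cancel]; exact one_mem_source
  have hm : ContMDiffAt 𝓘(ℝ, ℂ × ℂ × ℂ) 𝓘(ℝ, ℂ × ℂ × ℂ) ∞ (fun h => chartA (h * g⁻¹)) g :=
    ContMDiffAt.comp g (contMDiffAt_chartA hs) (contMDiffAt_id.mul contMDiffAt_const)
  have hg : ContMDiffAt 𝓘(ℝ, ℂ × ℂ × ℂ) 𝓘(ℝ, ℝ) ∞ (fun w => Φ (chartA.symm w * g))
      (chartA (g * g⁻¹)) := by
    rw [mul_inv_cancel, chartA_one]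
    exact (h g).contMDiffAt
  refine (hg.comp g hm).congr_of_eventuallyEq ?_
  filter_upwards [eventually_chartA_symm_chartA (f := fun h => h * g⁻¹) (by fun_prop) hs] with h hh
  simp only [Function.comp, hh, inv_mul_cancel_right]

/-- The line through the origin of the chart `chartA` with direction `ξ`. -/
def line (ξ : ℂ × ℂ × ℂ) (t : ℝ) : ℂ × ℂ × ℂ := base + t • ξ

theorem hasDerivAt_line (ξ : ℂ × ℂ × ℂ) (t : ℝ) : HasDerivAt (line ξ) ξ t := by
  unfold line
  simpa using ((hasDerivAt_id t).smul_const ξ).const_add base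

theorem line_zero (ξ : ℂ × ℂ × ℂ) : line ξ 0 = base := by simp [line]

theorem contDiff_line (ξ : ℂ × ℂ × ℂ) : ContDiff ℝ ∞ (line ξ) := by
  unfold line; fun_prop

/-- Joint smoothness of `(t, g) ↦ Φ (σ(t) g)`, where `σ` is the curve of coordinates `line ξ`. -/
theorem contMDiffAt_line_mul {Φ : SpinPlus13 → ℝ} (hΦ : ContMDiff 𝓘(ℝ, ℂ × ℂ × ℂ) 𝓘(ℝ, ℝ) ∞ Φ)
    (ξ : ℂ × ℂ × ℂ) {E H N : Type*} [NormedAddCommGroup E] [NormedSpace ℝ E]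
    [TopologicalSpace H] {I : ModelWithCorners ℝ E H} [TopologicalSpace N] [ChartedSpace H N]
    {a : N → ℝ} {b : N → SpinPlus13} {x : N} (ha : ContMDiffAt I 𝓘(ℝ, ℝ) ∞ a x)
    (hb : ContMDiffAt I 𝓘(ℝ, ℂ × ℂ × ℂ) ∞ b x) (hx : line ξ (a x) ∈ chartA.target) :
    ContMDiffAt I 𝓘(ℝ, ℝ) ∞ (fun y => Φ (chartA.symm (line ξ (a y)) * b y)) x := by
  have h1 : ContMDiffAt I 𝓘(ℝ, ℂ × ℂ × ℂ) ∞ (fun y => line ξ (a y)) x :=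
    (contDiff_line ξ).contMDiff.contMDiffAt.comp x ha
  have h2 : ContMDiffAt I 𝓘(ℝ, ℂ × ℂ × ℂ) ∞ (fun y => chartA.symm (line ξ (a y))) x :=
    ContMDiffAt.comp x (contMDiffAt_chartA_symm hx) h1
  exact hΦ.contMDiffAt.comp x (h2.mul hb)

theorem differentiableAt_line_mul {Φ : SpinPlus13 → ℝ}
    (hΦ : ContMDiff 𝓘(ℝ, ℂ × ℂ × ℂ) 𝓘(ℝ, ℝ) ∞ Φ) (ξ : ℂ × ℂ × ℂ) {t : ℝ} (g : SpinPlus13)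
    (ht : line ξ t ∈ chartA.target) :
    DifferentiableAt ℝ (fun s => Φ (chartA.symm (line ξ s) * g)) t :=
  (contMDiffAt_line_mul hΦ ξ (I := 𝓘(ℝ, ℝ)) contMDiffAt_id contMDiffAt_const
    ht).contDiffAt.differentiableAt (by simp)

theorem continuousAt_deriv_line_mul {Φ : SpinPlus13 → ℝ}
    (hΦ : ContMDiff 𝓘(ℝ, ℂ × ℂ × ℂ) 𝓘(ℝ, ℝ) ∞ Φ) (ξ : ℂ × ℂ × ℂ) {t : ℝ} (g : SpinPlus13)
    (ht : line ξ t ∈ chartA.target) :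
    ContinuousAt (fun p : ℝ × SpinPlus13 =>
      deriv (fun s => Φ (chartA.symm (line ξ s) * p.2)) p.1) (t, g) := by
  have h := ContMDiffAt.mfderiv (I := 𝓘(ℝ, ℝ)) (I' := 𝓘(ℝ, ℝ)) (m := 0) (n := ∞)
    (J := 𝓘(ℝ, ℝ).prod 𝓘(ℝ, ℂ × ℂ × ℂ))
    (fun (p : ℝ × SpinPlus13) (s : ℝ) => Φ (chartA.symm (line ξ s) * p.2)) Prod.fst (x₀ := (t, g))
    (contMDiffAt_line_mul hΦ ξ contMDiffAt_snd
      (ContMDiffAt.comp _ contMDiffAt_snd contMDiffAt_fst) ht) contMDiffAt_fst (by simp)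
  have h' : ContinuousAt (fun p : ℝ × SpinPlus13 =>
      fderiv ℝ (fun s => Φ (chartA.symm (line ξ s) * p.2)) p.1) (t, g) := by
    refine (h.continuousAt).congr (Filter.Eventually.of_forall fun p => ?_)
    simp only [mfderiv_eq_fderiv]
    exact congrFun (inTangentCoordinates_model_space (𝕜 := ℝ) (N := ℝ × SpinPlus13) Prod.fst
      (fun p : ℝ × SpinPlus13 => Φ (chartA.symm (line ξ p.1) * p.2))
      (fun p => fderiv ℝ (fun s => Φ (chartA.symm (line ξ s) * p.2)) p.1) (t, g)) p
  exact h'.clm_apply (continuousAt_const (y := (1 : ℝ)))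

/-- The integral of a derivative along a right-invariant vector field over a compact quotient
vanishes, for an invariant measure. -/
theorem exists_lift_integral_eq_zero (Γ : Subgroup SpinPlus13) [T2Space (SpinPlus13 ⧸ Γ)]
    [CompactSpace (SpinPlus13 ⧸ Γ)] [MeasurableSpace SpinPlus13] [BorelSpace SpinPlus13]
    (μ : Measure (SpinPlus13 ⧸ Γ)) [IsFiniteMeasure μ] [SMulInvariantMeasure SpinPlus13 _ μ]
    {Φ : SpinPlus13 → ℝ} (hΦ : ContMDiff 𝓘(ℝ, ℂ × ℂ × ℂ) 𝓘(ℝ, ℝ) ∞ Φ)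
    (hinv : ∀ g, ∀ γ ∈ Γ, Φ (g * γ) = Φ g) (ξ : ℂ × ℂ × ℂ) :
    ∃ ψ : SpinPlus13 ⧸ Γ → ℝ, Integrable ψ μ ∧ ∫ q, ψ q ∂μ = 0 ∧
      ∀ g : SpinPlus13, ψ g = fderiv ℝ (fun w => Φ (chartA.symm w * g)) base ξ := by
  obtain ⟨φ, hφ⟩ : ∃ φ : SpinPlus13 ⧸ Γ → ℝ, ∀ g : SpinPlus13, φ g = Φ g :=
    ⟨fun q => Quotient.liftOn' q Φ fun a b hab => by
      have := hinv a _ (QuotientGroup.leftRel_apply.1 hab)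
      simpa using this.symm, fun g => rfl⟩
  have hφc : Continuous φ :=
    QuotientGroup.isOpenQuotientMap_mk.isQuotientMap.continuous_iff.2
      (hΦ.continuous.congr fun g => (hφ g).symm)
  -- The curve through the unit element along which functions are translated.
  let c : ℝ → SpinPlus13 := fun t => chartA.symm (line ξ t)
  have hmk (t : ℝ) (g : SpinPlus13) : φ (c t • (g : SpinPlus13 ⧸ Γ)) = Φ (c t * g) := by
    rw [← hφ]; rfl
  obtain ⟨ε, hε, hball⟩ : ∃ ε > 0, ∀ t ∈ Metric.closedBall (0 : ℝ) ε, line ξ t ∈ chartA.target := by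
    have : (line ξ) ⁻¹' chartA.target ∈ 𝓝 (0 : ℝ) := by
      refine (contDiff_line ξ).continuous.continuousAt ?_
      rw [line_zero]
      exact chartA.open_target.mem_nhds base_mem_target
    exact Metric.nhds_basis_closedBall.mem_iff.1 this
  let f' : ℝ → SpinPlus13 ⧸ Γ → ℝ := fun t q => deriv (fun s => φ (c s • q)) t
  have hf'c : ContinuousOn (fun p : ℝ × (SpinPlus13 ⧸ Γ) => f' p.1 p.2)
      (Metric.closedBall 0 ε ×ˢ univ) := by
    rintro ⟨t, q⟩ ⟨ht, -⟩
    induction q using QuotientGroup.induction_on with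
    | H g =>
      refine ContinuousAt.continuousWithinAt ?_
      refine ((IsOpenQuotientMap.id.prodMap
        (QuotientGroup.isOpenQuotientMap_mk (N := Γ))).continuousAt_comp_iff (x := (t, g))).1 ?_
      refine (continuousAt_deriv_line_mul hΦ ξ g (hball t ht)).congr ?_
      refine Filter.Eventually.of_forall fun p => ?_
      simp only [Function.comp, Prod.map, f', hmk, id]
      rfl
  obtain ⟨C, hC⟩ := ((isCompact_closedBall (0 : ℝ) ε).prod isCompact_univ).exists_bound_of_continuousOn hf'c
  have hf'0 : Continuous (f' 0) := by
    refine continuousOn_univ.1 ?_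
    exact hf'c.comp (f := fun q => ((0 : ℝ), q)) (by fun_prop)
      fun q _ => ⟨Metric.mem_closedBall_self hε.le, mem_univ _⟩
  have hint (u : SpinPlus13 ⧸ Γ → ℝ) (hu : Continuous u) : Integrable u μ :=
    hu.integrable_of_hasCompactSupport (HasCompactSupport.of_compactSpace u)
  have hφs (t : ℝ) : Continuous fun q => φ (c t • q) := hφc.comp (continuous_const_smul _)
  -- Differentiation under the integral sign, along the translations by `c t`.
  have key := hasDerivAt_integral_of_dominated_loc_of_deriv_le (μ := μ)
    (F := fun t q => φ (c t • q)) (F' := f') (x₀ := (0 : ℝ)) (s := Metric.closedBall 0 ε)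
    (bound := fun _ => C) (Metric.closedBall_mem_nhds _ hε)
    (Filter.Eventually.of_forall fun t => (hφs t).aestronglyMeasurable) (hint _ (hφs 0))
    hf'0.aestronglyMeasurable
    (Filter.Eventually.of_forall fun q t ht => hC (t, q) ⟨ht, mem_univ _⟩) (integrable_const C)
    (Filter.Eventually.of_forall fun q t ht => by
      induction q using QuotientGroup.induction_on with
      | H g =>
        simp only [f', hmk]
        exact (differentiableAt_line_mul hΦ ξ g (hball t ht)).hasDerivAt)
  refine ⟨f' 0, key.1, ?_, fun g => ?_⟩
  · have h1 : (fun t => ∫ q, φ (c t • q) ∂μ) = fun _ => ∫ q, φ q ∂μ := by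
      funext t
      exact integral_smul_eq_self φ
    have h2 := key.2
    rw [h1] at h2
    exact h2.unique (hasDerivAt_const _ _)
  · simp only [f', hmk]
    have hd : DifferentiableAt ℝ (fun w => Φ (chartA.symm w * g)) (line ξ 0) := by
      rw [line_zero]
      have h : ContMDiffAt 𝓘(ℝ, ℂ × ℂ × ℂ) 𝓘(ℝ, ℝ) ∞ (fun w => Φ (chartA.symm w * g)) base :=
        hΦ.contMDiffAt.comp base
          ((contMDiffAt_chartA_symm base_mem_target).mul contMDiffAt_const)
      exact h.contDiffAt.differentiableAt (by simp)
    have := (hd.hasFDerivAt.comp_hasDerivAt (0 : ℝ) (hasDerivAt_line ξ 0)).deriv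
    rw [line_zero] at this
    exact this

/-- A divergence on the quotient by a discrete cocompact subgroup that is constant vanishes. -/
theorem eq_zero_of_sum_fderiv_eq (Γ : Subgroup SpinPlus13) [DiscreteTopology Γ]
    [CompactSpace (SpinPlus13 ⧸ Γ)] {ι : Type*} [Fintype ι] {Φ : ι → SpinPlus13 → ℝ}
    (hΦ : ∀ i, ContMDiff 𝓘(ℝ, ℂ × ℂ × ℂ) 𝓘(ℝ, ℝ) ∞ (Φ i))
    (hinv : ∀ i g, ∀ γ ∈ Γ, Φ i (g * γ) = Φ i g) (s : ι → ℝ) (ξ : ι → ℂ × ℂ × ℂ) (r : ℝ)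
    (h : ∀ g, ∑ i, s i • fderiv ℝ (fun w => Φ i (chartA.symm w * g)) base (ξ i) = r) : r = 0 := by
  borelize SpinPlus13
  have := isMulRightInvariant_haar (Measure.haar : Measure SpinPlus13)
  have hΓ : IsClosed (Γ : Set SpinPlus13) := Subgroup.isClosed_of_discrete
  obtain ⟨μ, hμ, hμ', hμ0⟩ :=
    exists_smulInvariantMeasure_quotient (Measure.haar : Measure SpinPlus13) Γ
  choose ψ hψ hψ0 hψg using fun i => exists_lift_integral_eq_zero Γ μ (hΦ i) (hinv i) (ξ i)
  have h1 : (fun q => ∑ i, s i • ψ i q) = fun _ => r := by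
    funext q
    induction q using QuotientGroup.induction_on with
    | H g => rw [← h g]; simp only [hψg]
  have h2 : ∫ q, ∑ i, s i • ψ i q ∂μ = 0 := by
    rw [integral_finsetSum _ fun i _ => by exact (hψ i).smul (s i)]
    simp [integral_const_mul, hψ0]
  rw [h1, integral_const, smul_eq_zero] at h2
  refine h2.resolve_left fun h3 => hμ0 ?_
  simpa [Measure.real, ENNReal.toReal_eq_zero_iff] using h3

end SpinPlus13

namespace SpinPlus13

open Topology

/-! ### Top degree forms on the orbits -/

theorem linearIndependent_pauli : LinearIndependent ℝ pauli := by
  rw [Fintype.linearIndependent_iff]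
  intro g hg
  simp only [Fin.sum_univ_six, pauli, Prod.ext_iff, Complex.ext_iff] at hg
  simp at hg
  obtain ⟨⟨h2, h5⟩, ⟨h04, h31⟩, h0, h13⟩ := hg
  intro i
  fin_cases i <;> simp <;> linarith

/-- The basis of the Lie algebra given by the Pauli matrices. -/
def pauliBasis : Module.Basis (Fin 6) ℝ (ℂ × ℂ × ℂ) :=
  basisOfLinearIndependentOfCardEqFinrank linearIndependent_pauli (by simp)

theorem coe_pauliBasis : ⇑pauliBasis = pauli :=
  coe_basisOfLinearIndependentOfCardEqFinrank _ _

/-- A linear map is injective if the pullback of some `6`-form by it does not vanish. -/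
theorem injective_of_apply_pauli_ne_zero {F : Type*} [NormedAddCommGroup F] [NormedSpace ℝ F]
    (α : F [⋀^Fin 6]→L[ℝ] ℝ) (L : (ℂ × ℂ × ℂ) →L[ℝ] F) (h : α (fun j => L (pauli j)) ≠ 0) :
    Function.Injective L := by
  have hli : LinearIndependent ℝ (L.toLinearMap ∘ pauli) := by
    by_contra hn
    exact h (α.toAlternatingMap.map_linearDependent _ hn)
  refine (injective_iff_map_eq_zero L).2 fun ξ hξ => ?_
  have hsum := pauliBasis.sum_repr ξ
  rw [coe_pauliBasis] at hsum
  have h0 := Fintype.linearIndependent_iff.1 hli (fun i => pauliBasis.repr ξ i) (by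
    have h1 := congrArg L hsum
    rw [hξ, map_sum] at h1
    simp only [map_smul] at h1
    exact h1)
  rw [← hsum]
  exact Finset.sum_eq_zero fun i _ => by rw [h0 i, zero_smul]

variable {F : Type*} [NormedAddCommGroup F] [NormedSpace ℝ F]
  {M : Type*} [TopologicalSpace M] [ChartedSpace F M]
  [MulAction SpinPlus13 M] [ContMDiffSMul 𝓘(ℝ, ℂ × ℂ × ℂ) 𝓘(ℝ, F) ∞ SpinPlus13 M]

theorem orbitCoeff_eq_zero_of_vanishes {k : ℕ} {θ : FormField F M k} {x : M} {g : SpinPlus13}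
    (h : θ.VanishesOnOrbitAt x g) (η : Fin k → ℂ × ℂ × ℂ) : orbitCoeff θ η (g • x) = 0 :=
  h _ fun i => (mem_orbitTangentSpace_iff (F := F) x g _).2 ⟨η i, rfl⟩

theorem vanishesOnOrbitAt_iff (θ : FormField F M 6) (x : M) (g : SpinPlus13) :
    θ.VanishesOnOrbitAt x g ↔ orbitCoeff θ pauli (g • x) = 0 := by
  refine ⟨fun h => orbitCoeff_eq_zero_of_vanishes h pauli, fun h v hv => ?_⟩
  choose η hη using fun i => (mem_orbitTangentSpace_iff (F := F) x g _).1 (hv i)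
  -- A top degree form on the Lie algebra that vanishes on a basis is zero.
  let α : (ℂ × ℂ × ℂ) [⋀^Fin 6]→ₗ[ℝ] ℝ :=
    (θ (g • x) : F [⋀^Fin 6]→L[ℝ] ℝ).toAlternatingMap.compLinearMap
      (generator F (g • x)).toLinearMap
  have hα : α = 0 := (α.map_basis_eq_zero_iff pauliBasis).1 (by rw [coe_pauliBasis]; exact h)
  have h2 : α η = 0 := by rw [hα]; rfl
  have h3 : v = fun i => generator F (g • x) (η i) := funext fun i => (hη i).symm
  rw [h3]
  exact h2

/-- The coefficient of an invariant top degree form in the frame of the generators is constant on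
each orbit, as the adjoint representation is unimodular. -/
theorem orbitCoeff_smul_of_isInvariant {E : FormField F M 6} (hE : E.IsInvariant) (g : SpinPlus13)
    (x : M) : orbitCoeff E pauli (g • x) = orbitCoeff E pauli x := by
  let α : (ℂ × ℂ × ℂ) [⋀^Fin 6]→ₗ[ℝ] ℝ :=
    (E x : F [⋀^Fin 6]→L[ℝ] ℝ).toAlternatingMap.compLinearMap (generator F x).toLinearMap
  have h1 : orbitCoeff E pauli (g • x) = α ((Ad g⁻¹).toLinearMap ∘ pauliBasis) := by
    rw [coe_pauliBasis, orbitCoeff]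
    simp only [generator_smul g x]
    exact DFunLike.congr_fun (hE g x) (fun j => generator F x (Ad g⁻¹ (pauli j)))
  have h2 : orbitCoeff E pauli x = α pauliBasis := by rw [coe_pauliBasis]; rfl
  rw [h1, h2, α.eq_smul_basis_det pauliBasis]
  rw [AlternatingMap.smul_apply, AlternatingMap.smul_apply, Module.Basis.det_comp, det_Ad, one_mul]

variable [IsManifold 𝓘(ℝ, F) ∞ M]

/-- The stabilizer of a point is discrete if some `6`-form does not vanish on its orbit. -/
theorem discreteTopology_stabilizer {E : FormField F M 6} {x : M}
    (h : orbitCoeff E pauli x ≠ 0) : DiscreteTopology (MulAction.stabilizer SpinPlus13 x) := by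
  obtain ⟨hb, hb'⟩ := (eventually_smul_mem_source F x).self_of_nhds
  have hu := (contDiffAt_orbitChart hb hb').differentiableAt (by simp)
  have h1 : orbitPullback E x base pauli ≠ 0 := by
    have := orbitPullback_rightField E pauli hb hb'
    simp only [rightField_base, chartA_symm_base, one_smul] at this
    rwa [← this] at h
  have hinj : Function.Injective (fderiv ℝ (orbitChart F x) base) :=
    injective_of_apply_pauli_ne_zero (E.inChart x (orbitChart F x base)) _ h1
  obtain ⟨C, -, hC⟩ := LinearMap.exists_antilipschitzWith
    (fderiv ℝ (orbitChart F x) base).toLinearMap (LinearMap.ker_eq_bot.2 hinj)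
  have hne : ∀ᶠ z in 𝓝[≠] base, orbitChart F x z ≠ orbitChart F x base :=
    hu.hasFDerivAt.eventually_ne ⟨C, hC⟩
  rw [eventually_nhdsWithin_iff] at hne
  have hcont : Filter.Tendsto chartA (𝓝 (1 : SpinPlus13)) (𝓝 base) := by
    rw [← chartA_one]
    exact chartA.continuousAt one_mem_source
  -- The orbit map is an immersion at `1`, so `1` is isolated in the stabilizer.
  have hev : ∀ᶠ g in 𝓝 (1 : SpinPlus13), g • x = x → g = 1 := by
    filter_upwards [hcont.eventually hne, chartA.open_source.mem_nhds one_mem_source] with g hg hgs hgx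
    by_contra hg1
    refine hg ?_ ?_
    · intro hgb
      refine hg1 (chartA.injOn hgs one_mem_source ?_)
      rw [chartA_one]; exact hgb
    · rw [orbitChart_base, orbitChart, chartA.left_inv hgs, hgx]
  refine discreteTopology_of_isOpen_singleton_one ?_
  rw [isOpen_iff_mem_nhds]
  rintro _ rfl
  filter_upwards [continuous_subtype_val.continuousAt.eventually hev] with g hg
  exact Subtype.ext (hg g.2)

/-- If the restriction of `dP` to an orbit vanishes nowhere, the support of the restriction of `P`
is the orbit. -/
theorem compactSpace_quotient {P : FormField F M 5} (hP : P.IsSmooth) {x : M}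
    (hsupp : P.HasCompactSupportOnOrbit x) (h : ∀ g : SpinPlus13, orbitCoeff P.d pauli (g • x) ≠ 0) :
    CompactSpace (SpinPlus13 ⧸ MulAction.stabilizer SpinPlus13 x) := by
  refine ⟨?_⟩
  unfold FormField.HasCompactSupportOnOrbit at hsupp
  convert! hsupp
  refine (Set.eq_univ_of_forall fun q => ?_).symm
  induction q using QuotientGroup.induction_on with
  | H g =>
    by_contra hg
    -- Outside the support, the coefficients of `P` vanish near `g`, hence so do their derivatives.
    refine h g ?_
    rw [orbitCoeff_d hP]
    refine Finset.sum_eq_zero fun i _ => ?_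
    have hc : ContinuousAt (fun w => ((chartA.symm w * g : SpinPlus13) :
        SpinPlus13 ⧸ MulAction.stabilizer SpinPlus13 x)) base :=
      QuotientGroup.continuous_mk.continuousAt.comp
        ((contMDiffAt_chartA_symm base_mem_target).continuousAt.mul continuousAt_const)
    have hev : (fun w => orbitCoeff P (i.removeNth pauli) (chartA.symm w • g • x)) =ᶠ[𝓝 base]
        fun _ => 0 := by
      filter_upwards [hc (isClosed_closure.isOpen_compl.mem_nhds (by
        simpa [chartA_symm_base] using hg))] with w hw
      rw [← mul_smul]
      refine orbitCoeff_eq_zero_of_vanishes ?_ _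
      by_contra hn
      exact hw (subset_closure ⟨_, hn, rfl⟩)
    rw [hev.fderiv_eq]
    simp

end SpinPlus13

end

open SpinPlus13 in
/-- Let `M` be a smooth manifold with a smooth action of `Spin⁺(1,3)`. If `E` is an invariant
`6`-form, `P` is a `5`-form whose restriction to every orbit has compact support, and
`E ≡ dP` modulo the ideal of the forms vanishing on each orbit, then `E ≡ dP ≡ 0`. -/
theorem mainTheorem5 {F : Type*} [NormedAddCommGroup F] [NormedSpace ℝ F] [FiniteDimensional ℝ F]
    {M : Type*} [TopologicalSpace M] [T2Space M] [SecondCountableTopology M]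
    [ChartedSpace F M] [IsManifold 𝓘(ℝ, F) ∞ M]
    [MulAction SpinPlus13 M] [ContMDiffSMul 𝓘(ℝ, ℂ × ℂ × ℂ) 𝓘(ℝ, F) ∞ SpinPlus13 M]
    (E : FormField F M 6) (hE : E.IsSmooth) (P : FormField F M 5) (hP : P.IsSmooth)
    (hinv : E.IsInvariant)
    (hsupp : ∀ x : M, P.HasCompactSupportOnOrbit x)
    (hEP : E - P.d ∈ orbitIdeal F M 6) :
    E ∈ orbitIdeal F M 6 ∧ P.d ∈ orbitIdeal F M 6 := by
  suffices hE0 : E ∈ orbitIdeal F M 6 by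
    refine ⟨hE0, ?_⟩
    have := (orbitIdeal F M 6).sub_mem hE0 hEP
    rwa [sub_sub_cancel] at this
  intro x g
  rw [vanishesOnOrbitAt_iff, orbitCoeff_smul_of_isInvariant hinv]
  have hdP (g : SpinPlus13) : orbitCoeff P.d pauli (g • x) = orbitCoeff E pauli x := by
    rw [← orbitCoeff_smul_of_isInvariant hinv g x]
    have h : orbitCoeff (E - P.d) pauli (g • x) = 0 := orbitCoeff_eq_zero_of_vanishes (hEP x g) pauli
    exact (sub_eq_zero.1 h).symm
  by_contra h0
  -- The divergence of the coefficients of `P` is the constant `orbitCoeff E pauli x`.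
  have := discreteTopology_stabilizer h0
  have := compactSpace_quotient hP (hsupp x) fun g => by rw [hdP g]; exact h0
  refine h0 (eq_zero_of_sum_fderiv_eq (MulAction.stabilizer SpinPlus13 x)
    (Φ := fun (i : Fin 6) g => orbitCoeff P (i.removeNth pauli) (g • x)) ?_ ?_
    (fun i => (-1) ^ i.val) pauli _ fun g => ?_)
  · refine fun i => contMDiff_of_contDiffAt_base fun g => ?_
    simp only [mul_smul]
    exact contDiffAt_orbitCoeff hP _ (g • x)
  · intro i g γ hγ
    simp only [mul_smul, MulAction.mem_stabilizer_iff.1 hγ]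
  · rw [← hdP g, orbitCoeff_d hP]
    simp only [mul_smul]
    exact Finset.sum_congr rfl fun i _ => by simp
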